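/- Let $\mathcal A$ be a unital (associative) algebra over $\mathbb C$ and $\varphi:\mathcal A\to\mathbb C$ a linear map with $\varphi(1)=1$. Let $D:\mathcal A\to\mathcal A$ be a derivation, i.e. a linear map with $D(ab)=D(a)b+aD(b)$ for all $a,b\in\mathcal A$. Fix an integer $k\ge 0$ and put $\varphi^{(i)}:=\varphi\circ D^i$ for $0\le i\le k$ (so $\varphi^{(0)}=\varphi$, $\varphi^{(0)}(1)=1$ and $\varphi^{(i)}(1)=0$ for $i\ge1$). The infinitesimal non-crossing cumulant functionals $\kappa_m^{(i)}:\mathcal A^m\to\mathbb C$ ($m\ge 1$, $0\le i\le k$) of $(\mathcal A,\varphi^{(0)},\varphi^{(1)},\ldots,\varphi^{(k)})$ are the functionals uniquely determined by the equations $$\sum_{p=\{V_1,\ldots,V_h\}\in NC(m)}\ \sum_{\substack{\lambda_1,\ldots,\lambda_h\ge 0\\ \lambda_1+\cdots+\lambda_h=i}}\frac{i!}{\lambda_1!\cdots\lambda_h!}\prod_{j=1}^h\kappa_{|V_j|}^{(\lambda_j)}\big((a_1,\ldots,a_m)\mid V_j\big)=\varphi^{(i)}(a_1\cdots a_m)$$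 for all $m\ge1$, $0\le i\le k$ and $a_1,\ldots,a_m\in\mathcal A$. Here $NC(m)$ is the set of non-crossing partitions of $\{1,\ldots,m\}$, and $(a_1,\ldots,a_m)\mid V=(a_{v_1},\ldots,a_{v_r})$ for $V=\{v_1<\cdots<v_r\}$. Let $\mathcal A_1,\ldots,\mathcal A_n$ be unital subalgebras of $\mathcal A$ which are free in $(\mathcal A,\varphi)$, that is, $\varphi(a_1\cdots a_m)=0$ whenever $m\ge1$, $a_s\in\mathcal A_{i_s}$ and $\varphi(a_s)=0$ for $1\le s\le m$, and $i_s\neq i_{s+1}$ for $1\le s<m$. Suppose that $D(\mathcal A_j)\subseteq\mathcal A_j$ for $1\le j\le n$. Then $\mathcal A_1,\ldots,\mathcal A_n$ are infinitesimally free of order $k$ in $(\mathcal A,\varphi,\varphi^{(1)},\ldots,\varphi^{(k)})$, that is, for each $0\le i\le k$ one has $\kappa_m^{(i)}(a_1,\ldots,a_m)=0$ whenever $a_1\in\mathcal A_{i_1},\ldots,a_m\in\mathcal A_{i_m}$ and there exist $1\le s<t\le m$ with $i_s\ne i_t$. -/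

import Mathlib

namespace FreeProb

/-! ### Non-crossing partitions of `{1 < ... < n}` (modelled on `Fin n`) -/

/-- A partition of `Fin n` is non-crossing if, whenever `a < b < c < d`, `a, c` lie in the block `V`
and `b, d` lie in the block `W`, one has `V = W`. -/
def IsNonCrossing {n : ℕ} (p : Finpartition (Finset.univ : Finset (Fin n))) : Prop :=
  ∀ V ∈ p.parts, ∀ W ∈ p.parts, ∀ a b c d : Fin n, a < b → b < c → c < d →
    a ∈ V → c ∈ V → b ∈ W → d ∈ W → V = W

instance instDecidableIsNonCrossing {n : ℕ} (p : Finpartition (Finset.univ : Finset (Fin n))) :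
    Decidable (IsNonCrossing p) := by
  unfold IsNonCrossing; infer_instance

/-- The set of non-crossing partitions of `Fin n`. -/
abbrev NC (n : ℕ) : Type :=
  {p : Finpartition (Finset.univ : Finset (Fin n)) // IsNonCrossing p}

/-- The type of blocks of a non-crossing partition. -/
abbrev NC.Block {n : ℕ} (p : NC n) : Type := {V : Finset (Fin n) // V ∈ p.1.parts}

/-- The subtuple `(a_1, ..., a_n) | V = (a_{v_1}, ..., a_{v_m})` for `V = {v_1 < ... < v_m}`. -/
def restrict {A : Type*} {n : ℕ} (a : Fin n → A) (V : Finset (Fin n)) : Fin V.card → A :=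
  fun j => a (V.orderEmbOfFin rfl j)

/-- The families `(l_V)` of natural numbers, indexed by a finite type, with sum `i`, where `i ≤ k`.
As the entries do not exceed `i`, they are taken in `Fin (k + 1) = {0, ..., k}`. -/
def weights (ι : Type*) [Fintype ι] [DecidableEq ι] {k : ℕ} (i : Fin (k + 1)) :
    Finset (ι → Fin (k + 1)) :=
  Finset.univ.filter fun l => ∑ V, (l V : ℕ) = (i : ℕ)

/-- `∑_l i! / ∏_V l_V! * ∏_V r_{|V|}^{(l_V)} ((a_1, ..., a_n) | V)`: the contribution of the
non-crossing partition `p`, the sum being over all families `l` indexed by the blocks of `p`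
with sum `i`. -/
noncomputable def blockSum {A : Type*} {k n : ℕ}
    (r : (m : ℕ) → Fin (k + 1) → (Fin m → A) → ℂ) (p : NC n) (i : Fin (k + 1)) (a : Fin n → A) :
    ℂ :=
  ∑ l ∈ weights p.Block i,
    (Nat.multinomial Finset.univ (fun V : p.Block => (l V : ℕ)) : ℂ) *
      ∏ V : p.Block, r V.1.card (l V) (restrict a V.1)

theorem card_block_lt {n : ℕ} {p : NC n} (hp : Finset.univ ∉ p.1.parts) (V : p.Block) :
    V.1.card < n := by
  have h : V.1 ≠ Finset.univ := fun h => hp (h.subst (motive := (· ∈ p.1.parts)) V.2)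
  simpa using Finset.card_lt_card (Finset.ssubset_univ_iff.mpr h)

theorem apply_restrict_univ {A : Type*} {k n : ℕ} (r : (m : ℕ) → Fin (k + 1) → (Fin m → A) → ℂ)
    (i : Fin (k + 1)) (a : Fin n → A) :
    r (Finset.univ : Finset (Fin n)).card i (restrict a Finset.univ) = r n i a := by
  have key : ∀ (m : ℕ) (h : (Finset.univ : Finset (Fin n)).card = m),
      r (Finset.univ : Finset (Fin n)).card i (restrict a Finset.univ) =
        r m i (fun j => a (Finset.univ.orderEmbOfFin h j)) := by
    intro m h
    subst h
    rfl
  rw [key n (by simp)]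
  congr 1
  funext j
  congr 1
  exact congrFun (Finset.orderEmbOfFin_unique (s := (Finset.univ : Finset (Fin n))) (by simp)
    (f := id) (fun x => Finset.mem_univ x) strictMono_id).symm j

theorem parts_eq_of_univ_mem {n : ℕ} {p : Finpartition (Finset.univ : Finset (Fin n))}
    (hp : Finset.univ ∈ p.parts) : p.parts = {Finset.univ} := by
  refine Finset.eq_singleton_iff_unique_mem.mpr ⟨hp, fun V hV => ?_⟩
  obtain ⟨x, hx⟩ := p.nonempty_of_mem_parts hV
  exact p.eq_of_mem_parts hV hp hx (Finset.mem_univ x)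

theorem blockSum_of_univ_mem {A : Type*} {k n : ℕ} (r : (m : ℕ) → Fin (k + 1) → (Fin m → A) → ℂ)
    (p : NC n) (hp : Finset.univ ∈ p.1.parts) (i : Fin (k + 1)) (a : Fin n → A) :
    blockSum r p i a = r n i a := by
  have hparts := parts_eq_of_univ_mem hp
  let V₀ : p.Block := ⟨Finset.univ, hp⟩
  have huniv : (Finset.univ : Finset p.Block) = {V₀} := by
    refine Finset.eq_singleton_iff_unique_mem.mpr ⟨Finset.mem_univ _, fun V _ => Subtype.ext ?_⟩
    exact Finset.mem_singleton.mp (hparts.subst (motive := (V.1 ∈ ·)) V.2)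
  have hw : weights p.Block i = {fun _ => i} := by
    ext l
    simp only [weights, huniv, Finset.sum_singleton, Finset.mem_filter, Finset.mem_singleton,
      Finset.mem_univ, true_and]
    constructor
    · intro h
      funext V
      have hV : V = V₀ := Finset.mem_singleton.mp (huniv ▸ Finset.mem_univ V)
      rw [hV]
      exact Fin.ext h
    · rintro rfl
      rfl
  unfold blockSum
  rw [hw, Finset.sum_singleton, huniv, Finset.prod_singleton, Nat.multinomial_singleton]
  rw [Nat.cast_one, one_mul]
  exact apply_restrict_univ r i a

theorem sum_blockSum {A : Type*} {k n : ℕ} (hn : 1 ≤ n) (r : (m : ℕ) → Fin (k + 1) → (Fin m → A) → ℂ)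
    (i : Fin (k + 1)) (a : Fin n → A) :
    ∑ p : NC n, blockSum r p i a =
      r n i a + ∑ p : {p : NC n // Finset.univ ∉ p.1.parts}, blockSum r p.1 i a := by
  have hne : (Finset.univ : Finset (Fin n)) ≠ ⊥ :=
    Finset.nonempty_iff_ne_empty.mp ⟨⟨0, hn⟩, Finset.mem_univ _⟩
  let q : NC n := ⟨Finpartition.indiscrete hne, by
    intro V hV W hW a b c d _ _ _ _ _ _ _
    rw [Finpartition.indiscrete_parts, Finset.mem_singleton] at hV hW
    rw [hV, hW]⟩
  have hq : Finset.univ ∈ q.1.parts := by simp [q]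
  rw [← Fintype.sum_subtype_add_sum_subtype (fun p : NC n => Finset.univ ∈ p.1.parts)]
  congr 1
  rw [Fintype.sum_eq_single (⟨q, hq⟩ : {p : NC n // Finset.univ ∈ p.1.parts})]
  · exact blockSum_of_univ_mem r q hq i a
  · intro p hpq
    refine absurd (Subtype.ext (Subtype.ext (Finpartition.ext ?_))) hpq
    rw [parts_eq_of_univ_mem p.2, parts_eq_of_univ_mem hq]

/-! ### Noncommutative probability spaces, freeness -/

section Spaces

variable (A : Type*) [Ring A] [Algebra ℂ A]

/-- A noncommutative probability space structure on the unital complex algebra `A`. -/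
structure NCProbSpace where
  φ : A →ₗ[ℂ] ℂ
  map_one : φ 1 = 1

/-- An infinitesimal noncommutative probability space of order `k` structure on `A`. -/
structure InfNCProbSpace (k : ℕ) where
  φ : Fin (k + 1) → A →ₗ[ℂ] ℂ
  map_one_zero : φ 0 1 = 1
  map_one_pos : ∀ i : Fin (k + 1), i ≠ 0 → φ i 1 = 0

end Spaces

section Main

variable {A : Type*} [Ring A] [Algebra ℂ A]

/-- Freeness of a family of unital subalgebras: `φ (a_0 a_1 ⋯ a_m) = 0` for every nonempty
product of centred elements in which neighbouring factors come from different subalgebras. -/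
def NCProbSpace.Free (P : NCProbSpace A) {ι : Type*} (B : ι → Subalgebra ℂ A) : Prop :=
  ∀ (m : ℕ) (j : Fin (m + 1) → ι) (a : Fin (m + 1) → A),
    (∀ s : Fin m, j s.castSucc ≠ j s.succ) →
    (∀ s, a s ∈ B (j s)) → (∀ s, P.φ (a s) = 0) →
    P.φ (List.ofFn a).prod = 0

/-- A derivation of the (not necessarily commutative) algebra `A`. -/
def IsDerivation (D : Module.End ℂ A) : Prop :=
  ∀ a b : A, D (a * b) = D a * b + a * D b

theorem IsDerivation.map_one {D : Module.End ℂ A} (hD : IsDerivation D) : D 1 = 0 := by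
  have h := hD 1 1
  simp only [one_mul, mul_one] at h
  exact left_eq_add.mp h

/-- `(A, φ, φ ∘ D, ..., φ ∘ D^k)`. -/
def NCProbSpace.upgrade (P : NCProbSpace A) (D : Module.End ℂ A) (hD : IsDerivation D) (k : ℕ) :
    InfNCProbSpace A k where
  φ i := P.φ ∘ₗ (D ^ (i : ℕ))
  map_one_zero := by simpa using P.map_one
  map_one_pos := by
    intro i hi
    obtain ⟨m, hm⟩ := Nat.exists_eq_succ_of_ne_zero (fun h => hi (Fin.ext h))
    simp [hm, pow_succ, hD.map_one]

/-! ### Infinitesimal non-crossing cumulants -/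

/-- The infinitesimal non-crossing cumulant functionals `κ_n^{(i)}` of order `k`: the solution of
the infinitesimal free moment-cumulant formula (`cumulant_formula`, `cumulant_unique`), obtained by
isolating in that formula the term of the one-block partition. -/
noncomputable def InfNCProbSpace.cumulant {k : ℕ} (P : InfNCProbSpace A k) :
    (n : ℕ) → Fin (k + 1) → (Fin n → A) → ℂ
  | n, i, a => P.φ i (List.ofFn a).prod -
      ∑ p : {p : NC n // Finset.univ ∉ p.1.parts}, ∑ l ∈ weights p.1.Block i,
        (Nat.multinomial Finset.univ (fun V : p.1.Block => (l V : ℕ)) : ℂ) *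
          ∏ V : p.1.Block, P.cumulant V.1.card (l V) (restrict a V.1)
termination_by n => n
decreasing_by exact card_block_lt p.2 V

/-- The infinitesimal free moment-cumulant formula. -/
theorem InfNCProbSpace.cumulant_formula {k : ℕ} (P : InfNCProbSpace A k) {n : ℕ} (hn : 1 ≤ n)
    (i : Fin (k + 1)) (a : Fin n → A) :
    ∑ p : NC n, blockSum P.cumulant p i a = P.φ i (List.ofFn a).prod := by
  rw [sum_blockSum hn, InfNCProbSpace.cumulant]
  simp only [blockSum]
  ring

/-- The infinitesimal free moment-cumulant formula determines the cumulant functionals. -/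
theorem InfNCProbSpace.cumulant_unique {k : ℕ} (P : InfNCProbSpace A k)
    (r : (m : ℕ) → Fin (k + 1) → (Fin m → A) → ℂ)
    (hr : ∀ n : ℕ, 1 ≤ n → ∀ (i : Fin (k + 1)) (a : Fin n → A),
      ∑ p : NC n, blockSum r p i a = P.φ i (List.ofFn a).prod) :
    ∀ n : ℕ, 1 ≤ n → r n = P.cumulant n := by
  intro n
  induction n using Nat.strong_induction_on with
  | _ n ih =>
    intro hn
    funext i a
    have h := hr n hn i a
    rw [← P.cumulant_formula hn i a, sum_blockSum hn, sum_blockSum hn] at h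
    have e : ∑ p : {p : NC n // Finset.univ ∉ p.1.parts}, blockSum r p.1 i a =
        ∑ p : {p : NC n // Finset.univ ∉ p.1.parts}, blockSum P.cumulant p.1 i a := by
      refine Finset.sum_congr rfl fun p _ => ?_
      unfold blockSum
      refine Finset.sum_congr rfl fun l _ => ?_
      congr 1
      refine Finset.prod_congr rfl fun V _ => ?_
      rw [ih V.1.card (card_block_lt p.2 V)
        (Finset.card_pos.mpr (p.1.1.nonempty_of_mem_parts V.2))]
    rw [e] at h
    exact add_right_cancel h

/-- Infinitesimal freeness of order `k` of a family of subsets: vanishing of mixed infinitesimal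
cumulants. -/
def InfNCProbSpace.InfFree {k : ℕ} (P : InfNCProbSpace A k) {ι : Type*} (M : ι → Set A) : Prop :=
  ∀ (i : Fin (k + 1)) (m : ℕ) (j : Fin m → ι) (a : Fin m → A),
    (∀ s, a s ∈ M (j s)) → (∃ s t : Fin m, s < t ∧ j s ≠ j t) →
    P.cumulant m i a = 0

end Main

end FreeProb

/-! The derivation exponentiates. In the algebra of formal power series over `A`, the map sending
`a` to the sum of `X ^ i D ^ i a / i!` is multiplicative by the Leibniz rule. Let `Φ` be the
coefficientwise extension of `φ`, with values in the commutative ring of complex power series. Then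
`φ (D ^ i (a₁ ⋯ aₘ))` is `i!` times the `i`-th coefficient of `Φ (exp a₁ ⋯ exp aₘ)`. Comparing
coefficients, the multinomial moment-cumulant formula becomes the ordinary one for `Φ`, so by
uniqueness `κ^(i)(a₁, …, aₘ)` is `i!` times the `i`-th coefficient of the free cumulant of `exp a₁,
…, exp aₘ` (`cumulant_upgrade`). Invariance under `D` puts `exp a` in the series over `B j`, and
freeness passes to these subalgebras because a series is centred exactly when all its coefficients
are (`NCProbSpace.Free.seriesFunctional_eq_zero`). It remains to show that mixed free cumulants
vanish over an arbitrary commutative ring.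

For this, sums over non-crossing partitions are computed by reading the word from left to right with
a stack of open blocks (`stackMoment`; the equivalence is `ncSum_subword`). Let `L` be the cumulant
on words of one colour and zero elsewhere. Reading a word against a stack of centred alternating
letters, `L` obeys the recursion by which the word is reduced to centred alternating form under `Φ`
(`stackMoment_letterStack`); freeness settles the end of the word. Hence `L` has the moments of `Φ`,
and by uniqueness it is the cumulant functional (`cumulant_eq_monochromaticCumulant`). -/

namespace FreeProb

/-! ### Moments computed with a stack of open blocks. -/

section StackMoments

variable {X R : Type*} [CommRing R]

/-- The moment of a word determined by a cumulant functional `K`, relative to a stack of open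
blocks. An open block with letters `u` is represented by the functional `v ↦ K (u ++ v)`. Every
letter is a singleton block, opens a block, continues the top block, or closes the top block. -/
def stackMoment (K : List X → R) : List (List X → R) → List X → R
  | [], [] => 1
  | _ :: _, [] => 0
  | [], x :: w => K [x] * stackMoment K [] w + stackMoment K [fun v => K (x :: v)] w
  | f :: s, x :: w =>
      K [x] * stackMoment K (f :: s) w + stackMoment K ((fun v => K (x :: v)) :: f :: s) w +
        (stackMoment K ((fun v => f (x :: v)) :: s) w + f [x] * stackMoment K s w)
termination_by _ w => w.length

variable {K : List X → R}

theorem stackMoment_nil_nil : stackMoment K [] [] = 1 := by simp [stackMoment]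

theorem stackMoment_cons_nil (f : List X → R) (s : List (List X → R)) :
    stackMoment K (f :: s) [] = 0 := by simp [stackMoment]

theorem stackMoment_nil_cons (x : X) (w : List X) :
    stackMoment K [] (x :: w) =
      K [x] * stackMoment K [] w + stackMoment K [fun v => K (x :: v)] w := by
  rw [stackMoment]

theorem stackMoment_cons_cons (f : List X → R) (s : List (List X → R)) (x : X) (w : List X) :
    stackMoment K (f :: s) (x :: w) =
      K [x] * stackMoment K (f :: s) w + stackMoment K ((fun v => K (x :: v)) :: f :: s) w +
        (stackMoment K ((fun v => f (x :: v)) :: s) w + f [x] * stackMoment K s w) := by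
  rw [stackMoment]

theorem stackMoment_append_nil (p : List (List X → R)) (f : List X → R)
    (s : List (List X → R)) : stackMoment K (p ++ f :: s) [] = 0 := by
  cases p <;> exact stackMoment_cons_nil _ _

/-- An open block must absorb at least one more letter before it closes, so every summand has a
factor `f v` with `v` a nonempty subword of `w`. The value of `f` at the empty word never matters.
-/
theorem stackMoment_eq_zero (w : List X) : ∀ (p : List (List X → R)) (f : List X → R)
    (s : List (List X → R)), (∀ v, v ≠ [] → v.length ≤ w.length → f v = 0) →
    stackMoment K (p ++ f :: s) w = 0 := by
  induction w with
  | nil => intro p f s _; exact stackMoment_append_nil p f s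
  | cons x w ih =>
    intro p f s hf
    have hf' : ∀ v, v ≠ [] → v.length ≤ w.length → f v = 0 :=
      fun v hv hl => hf v hv (hl.trans (by simp))
    have hfx : ∀ v, v ≠ [] → v.length ≤ w.length → f (x :: v) = 0 :=
      fun v _ hl => hf _ (by simp) (by simpa using hl)
    cases p with
    | nil =>
      have h1 := ih [] f s hf'
      have h2 := ih [fun v => K (x :: v)] f s hf'
      have h3 := ih [] (fun v => f (x :: v)) s hfx
      simp only [List.nil_append, List.cons_append] at h1 h2 h3 ⊢
      rw [stackMoment_cons_cons, h1, h2, h3, hf [x] (by simp) (by simp)]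
      ring
    | cons g p =>
      have h1 := ih (g :: p) f s hf'
      have h2 := ih ((fun v => K (x :: v)) :: g :: p) f s hf'
      have h3 := ih ((fun v => g (x :: v)) :: p) f s hf'
      have h4 := ih p f s hf'
      simp only [List.cons_append] at h1 h2 h3 ⊢
      rw [stackMoment_cons_cons, h1, h2, h3, h4]
      ring

/-- Each open block contributes exactly one factor to each summand, so the moment is linear in every
entry of the stack. -/
theorem stackMoment_add (w : List X) : ∀ (p : List (List X → R)) (f g : List X → R)
    (s : List (List X → R)), stackMoment K (p ++ (f + g) :: s) w =
      stackMoment K (p ++ f :: s) w + stackMoment K (p ++ g :: s) w := by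
  induction w with
  | nil => intro p f g s; simp only [stackMoment_append_nil, add_zero]
  | cons x w ih =>
    intro p f g s
    cases p with
    | nil =>
      have h1 := ih [] f g s
      have h2 := ih [fun v => K (x :: v)] f g s
      have h3 := ih [] (fun v => f (x :: v)) (fun v => g (x :: v)) s
      have e : (fun v => (f + g) (x :: v)) = (fun v => f (x :: v)) + fun v => g (x :: v) := rfl
      simp only [List.nil_append, List.cons_append] at h1 h2 h3 ⊢
      rw [stackMoment_cons_cons, stackMoment_cons_cons, stackMoment_cons_cons, e, h1, h2, h3,
        Pi.add_apply]
      ring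
    | cons q p =>
      have h1 := ih (q :: p) f g s
      have h2 := ih ((fun v => K (x :: v)) :: q :: p) f g s
      have h3 := ih ((fun v => q (x :: v)) :: p) f g s
      have h4 := ih p f g s
      simp only [List.cons_append] at h1 h2 h3 ⊢
      rw [stackMoment_cons_cons, stackMoment_cons_cons, stackMoment_cons_cons, h1, h2, h3, h4]
      ring

theorem stackMoment_smul (c : R) (w : List X) : ∀ (p : List (List X → R)) (f : List X → R)
    (s : List (List X → R)), stackMoment K (p ++ (c • f) :: s) w =
      c * stackMoment K (p ++ f :: s) w := by
  induction w with
  | nil => intro p f s; simp only [stackMoment_append_nil, mul_zero]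
  | cons x w ih =>
    intro p f s
    cases p with
    | nil =>
      have h1 := ih [] f s
      have h2 := ih [fun v => K (x :: v)] f s
      have h3 := ih [] (fun v => f (x :: v)) s
      have e : (fun v => (c • f) (x :: v)) = c • fun v => f (x :: v) := rfl
      simp only [List.nil_append, List.cons_append] at h1 h2 h3 ⊢
      rw [stackMoment_cons_cons, stackMoment_cons_cons, e, h1, h2, h3, Pi.smul_apply, smul_eq_mul]
      ring
    | cons q p =>
      have h1 := ih (q :: p) f s
      have h2 := ih ((fun v => K (x :: v)) :: q :: p) f s
      have h3 := ih ((fun v => q (x :: v)) :: p) f s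
      have h4 := ih p f s
      simp only [List.cons_append] at h1 h2 h3 ⊢
      rw [stackMoment_cons_cons, stackMoment_cons_cons, h1, h2, h3, h4]
      ring

/-- The sum of `f v₁ * g v₂` over the factorizations `v = v₁ ++ v₂` into nonempty words. -/
def splitSum (f g : List X → R) : List X → R
  | [] => 0
  | [_] => 0
  | x :: y :: v => f [x] * g (y :: v) + splitSum (fun u => f (x :: u)) g (y :: v)

theorem splitSum_cons (f g : List X → R) (x : X) {v : List X} (hv : v ≠ []) :
    splitSum f g (x :: v) = f [x] * g v + splitSum (fun u => f (x :: u)) g v := by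
  cases v with
  | nil => exact absurd rfl hv
  | cons y v => rfl

theorem stackMoment_congr (w : List X) (p : List (List X → R)) {f g : List X → R}
    (s : List (List X → R)) (h : ∀ v, v ≠ [] → v.length ≤ w.length → f v = g v) :
    stackMoment K (p ++ f :: s) w = stackMoment K (p ++ g :: s) w := by
  have e : f = (f + (-1 : R) • g) + g := by ext v; simp
  rw [e, stackMoment_add, stackMoment_eq_zero w p _ s fun v hv hl => by simp [h v hv hl], zero_add]

/-- With `f` above `g`, the block of `f` must be closed before that of `g` receives a letter. The
letters taken by the two blocks thus form one word cut in two, and the blocks nested in its gaps are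
the same on both sides. -/
theorem stackMoment_splitSum (w : List X) : ∀ (p : List (List X → R)) (f g : List X → R)
    (s : List (List X → R)), stackMoment K (p ++ splitSum f g :: s) w =
      stackMoment K (p ++ f :: g :: s) w := by
  induction w with
  | nil => intro p f g s; simp only [stackMoment_append_nil]
  | cons x w ih =>
    intro p f g s
    cases p with
    | nil =>
      have h1 := ih [] f g s
      have h2 := ih [fun v => K (x :: v)] f g s
      have h3 := ih [] (fun v => f (x :: v)) g s
      have h4 := stackMoment_congr (K := K) w [] s
        (f := fun v => splitSum f g (x :: v)) (g := f [x] • g + splitSum (fun u => f (x :: u)) g)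
        fun v hv _ => by simp [splitSum_cons f g x hv]
      have h5 := stackMoment_add (K := K) w [] (f [x] • g) (splitSum (fun u => f (x :: u)) g) s
      have h6 := stackMoment_smul (K := K) (f [x]) w [] g s
      have e : splitSum f g [x] = 0 := rfl
      simp only [List.nil_append, List.cons_append] at h1 h2 h3 h4 h5 h6 ⊢
      rw [stackMoment_cons_cons, stackMoment_cons_cons, h1, h2, h4, h5, h6, h3, e]
      ring
    | cons q p =>
      have h1 := ih (q :: p) f g s
      have h2 := ih ((fun v => K (x :: v)) :: q :: p) f g s
      have h3 := ih ((fun v => q (x :: v)) :: p) f g s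
      have h4 := ih p f g s
      simp only [List.cons_append] at h1 h2 h3 ⊢
      rw [stackMoment_cons_cons, stackMoment_cons_cons, h1, h2, h3, h4]

/-- Triangularity: the only surviving summand is the one in which the open block absorbs the whole
of `w`. -/
theorem stackMoment_singleton_eq (w : List X) (hw : w ≠ []) : ∀ f : List X → R,
    (∀ v, v ≠ [] → v.length < w.length → f v = 0) → stackMoment K [f] w = f w := by
  induction w with
  | nil => exact absurd rfl hw
  | cons x w ih =>
    intro f hf
    have hf' : ∀ v, v ≠ [] → v.length ≤ w.length → f v = 0 :=
      fun v hv hl => hf v hv (by simpa [Nat.lt_succ_iff] using hl)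
    have h1 := stackMoment_eq_zero (K := K) w [] f [] hf'
    have h2 := stackMoment_eq_zero (K := K) w [fun v => K (x :: v)] f [] hf'
    simp only [List.nil_append, List.cons_append] at h1 h2
    rw [stackMoment_cons_cons, h1, h2]
    rcases eq_or_ne w [] with rfl | hne
    · simp [stackMoment_cons_nil, stackMoment_nil_nil]
    · rw [ih hne _ fun v hv hl => hf _ (by simp) (by simpa using hl),
        hf [x] (by simp) (by simpa [List.length_pos_iff] using hne)]
      ring

/-- A functional is determined on nonempty words by the moments with it as the only open block. -/
theorem eq_zero_of_stackMoment_eq_zero {f : List X → R} (h : ∀ w, stackMoment K [f] w = 0) :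
    ∀ w, w ≠ [] → f w = 0 := by
  intro w
  induction hn : w.length using Nat.strong_induction_on generalizing w with
  | _ n ih =>
    intro hw
    rw [← stackMoment_singleton_eq (K := K) w hw f fun v hv hl => ih _ (hn ▸ hl) v rfl hv]
    exact h w

theorem stackMoment_congr_cumulant {K' : List X → R} (w : List X) :
    ∀ s : List (List X → R), (∀ v, v ≠ [] → v.length ≤ w.length → K v = K' v) →
    stackMoment K s w = stackMoment K' s w := by
  induction w with
  | nil => intro s _; cases s <;> simp [stackMoment]
  | cons x w ih =>
    intro s h
    have h' : ∀ v, v ≠ [] → v.length ≤ w.length → K v = K' v :=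
      fun v hv hl => h v hv (hl.trans (by simp))
    have hx : K [x] = K' [x] := h _ (by simp) (by simp)
    have hc : ∀ s, stackMoment K' ((fun v => K (x :: v)) :: s) w =
        stackMoment K' ((fun v => K' (x :: v)) :: s) w := fun s =>
      stackMoment_congr w [] s fun v _ hl => h _ (by simp) (by simpa using hl)
    cases s with
    | nil => rw [stackMoment_nil_cons, stackMoment_nil_cons, ih _ h', ih _ h', hx, hc]
    | cons f s =>
      rw [stackMoment_cons_cons, stackMoment_cons_cons, ih _ h', ih _ h', ih _ h', ih _ h', hx, hc]

/-- The moment of a word depends on the cumulant of the full word through this cumulant itself. -/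
theorem stackMoment_sub_stackMoment {K' : List X → R} (w : List X) (hw : w ≠ [])
    (h : ∀ v, v ≠ [] → v.length < w.length → K v = K' v) :
    stackMoment K [] w - stackMoment K' [] w = K w - K' w := by
  cases w with
  | nil => exact absurd rfl hw
  | cons x w =>
    have h' : ∀ v, v ≠ [] → v.length ≤ w.length → K v = K' v :=
      fun v hv hl => h v hv (by simpa [Nat.lt_succ_iff] using hl)
    rw [stackMoment_nil_cons, stackMoment_nil_cons, stackMoment_congr_cumulant w _ h',
      stackMoment_congr_cumulant w _ h']
    rcases eq_or_ne w [] with rfl | hne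
    · simp [stackMoment_cons_nil, stackMoment_nil_nil]
    · have hx : K [x] = K' [x] := h' _ (by simp) (by simpa [Nat.one_le_iff_ne_zero] using hne)
      have e : (fun v => K (x :: v)) =
          ((fun v => K (x :: v)) + (-1 : R) • fun v => K' (x :: v)) + fun v => K' (x :: v) := by
        ext v; simp
      have h1 := stackMoment_add (K := K') w []
        ((fun v => K (x :: v)) + (-1 : R) • fun v => K' (x :: v)) (fun v => K' (x :: v)) []
      have h2 := stackMoment_singleton_eq (K := K') w hne
        ((fun v => K (x :: v)) + (-1 : R) • fun v => K' (x :: v)) fun v _ hl => by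
          simp [h (x :: v) (by simp) (by simpa using hl)]
      simp only [List.nil_append] at h1
      rw [e, h1, h2, hx]
      simp only [Pi.add_apply, Pi.smul_apply, smul_eq_mul]
      ring

/-- The cumulant functional of a moment functional `M`. -/
noncomputable def wordCumulant (M : List X → R) (w : List X) : R :=
  -- The value 0 at words of full length removes the one-block term, the only one that involves the
  -- cumulant being defined.
  M w - stackMoment (fun v => if v.length < w.length then wordCumulant M v else 0) [] w
termination_by w.length

theorem stackMoment_wordCumulant (M : List X → R) (hM : M [] = 1) (w : List X) :
    stackMoment (wordCumulant M) [] w = M w := by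
  rcases eq_or_ne w [] with rfl | hw
  · rw [stackMoment_nil_nil, hM]
  · have h := stackMoment_sub_stackMoment (K := wordCumulant M)
      (K' := fun v => if v.length < w.length then wordCumulant M v else 0) w hw
      fun v _ hl => by simp [hl]
    rw [if_neg (lt_irrefl _), sub_zero, wordCumulant] at h
    linear_combination h

end StackMoments

/-! ### Vanishing of mixed free cumulants over a commutative ring. -/

section MixedCumulants

variable {R 𝒜 ι : Type*} [CommRing R] {K : List 𝒜 → R}

theorem stackMoment_map {X Y : Type*} (L : List Y → R) (π : X → Y) (w : List X) :
    ∀ s : List (List Y → R),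
      stackMoment (fun v => L (v.map π)) (s.map fun f v => f (v.map π)) w =
        stackMoment L s (w.map π) := by
  induction w with
  | nil => intro s; cases s <;> simp [stackMoment]
  | cons x w ih =>
    intro s
    cases s with
    | nil =>
      have h1 := ih []
      have h2 := ih [fun v => L (π x :: v)]
      simp only [List.map_cons, List.map_nil] at h1 h2 ⊢
      rw [stackMoment_nil_cons, stackMoment_nil_cons]
      simp only [List.map_cons, List.map_nil, h1, h2]
    | cons f s =>
      have h1 := ih (f :: s)
      have h2 := ih ((fun v => L (π x :: v)) :: f :: s)
      have h3 := ih ((fun v => f (π x :: v)) :: s)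
      have h4 := ih s
      simp only [List.map_cons] at h1 h2 h3 ⊢
      rw [stackMoment_cons_cons, stackMoment_cons_cons]
      simp only [List.map_cons, List.map_nil, h1, h2, h3, h4]

theorem splitSum_eq_zero {X : Type*} (v : List X) : ∀ f g : List X → R,
    (∀ v₁ v₂, v₁ ++ v₂ = v → v₁ ≠ [] → v₂ ≠ [] → f v₁ * g v₂ = 0) → splitSum f g v = 0 := by
  induction v with
  | nil => intro f g _; rfl
  | cons x v ih =>
    intro f g h
    rcases eq_or_ne v [] with rfl | hv
    · rfl
    · rw [splitSum_cons f g x hv, h [x] v rfl (by simp) hv, ih _ _ fun v₁ v₂ e h₁ h₂ =>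
        h (x :: v₁) v₂ (by simp [e]) (by simp) h₂, add_zero]

theorem splitSum_map {X Y : Type*} (π : X → Y) (v : List X) : ∀ (f g : List X → R)
    (f' g' : List Y → R),
    (∀ v₁ v₂, v₁ ++ v₂ = v → v₁ ≠ [] → v₂ ≠ [] → f v₁ = f' (v₁.map π) ∧ g v₂ = g' (v₂.map π)) →
    splitSum f g v = splitSum f' g' (v.map π) := by
  induction v with
  | nil => intro f g f' g' _; rfl
  | cons x v ih =>
    intro f g f' g' h
    rcases eq_or_ne v [] with rfl | hv
    · rfl
    · obtain ⟨h₁, h₂⟩ := h [x] v rfl (by simp) hv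
      rw [List.map_cons, splitSum_cons f g x hv, splitSum_cons f' g' _ (by simpa using hv), h₁, h₂,
        ih _ g (fun u => f' (π x :: u)) g' fun v₁ v₂ e h₁ h₂ =>
          h (x :: v₁) v₂ (by simp [e]) (by simp) h₂]
      rfl

open Classical in
/-- The functional on words of coloured elements which is the cumulant on words of a single colour
and vanishes on the other words. -/
noncomputable def monochromaticCumulant (K : List 𝒜 → R) : List (ι × 𝒜) → R
  | [] => 0
  | x :: v => if ∀ y ∈ v, y.1 = x.1 then K (x.2 :: v.map Prod.snd) else 0

theorem monochromaticCumulant_singleton (x : ι × 𝒜) :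
    monochromaticCumulant K [x] = K [x.2] := by
  simp [monochromaticCumulant]

theorem monochromaticCumulant_eq_zero {x y : ι × 𝒜} {v : List (ι × 𝒜)} (hy : y ∈ v)
    (h : y.1 ≠ x.1) : monochromaticCumulant K (x :: v) = 0 := by
  rw [monochromaticCumulant, if_neg fun hv => h (hv y hy)]

theorem monochromaticCumulant_of_forall {x : ι × 𝒜} {v : List (ι × 𝒜)}
    (h : ∀ y ∈ v, y.1 = x.1) :
    monochromaticCumulant K (x :: v) = K (x.2 :: v.map Prod.snd) := by
  rw [monochromaticCumulant, if_pos h]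

/-- The stack of open blocks consisting of the single letters of `c`. -/
noncomputable def letterStack (K : List 𝒜 → R) (c : List (ι × 𝒜)) : List (List (ι × 𝒜) → R) :=
  c.map fun x v => monochromaticCumulant K (x :: v)

theorem letterStack_cons (x : ι × 𝒜) (c : List (ι × 𝒜)) :
    letterStack K (x :: c) = (fun v => monochromaticCumulant K (x :: v)) :: letterStack K c := rfl

variable [Ring 𝒜] [Algebra R 𝒜] {Φ : 𝒜 →ₗ[R] R}

theorem cumulant_singleton_eq (hΦ : Φ 1 = 1)
    (hK : ∀ w, stackMoment K [] w = Φ w.prod) (x : 𝒜) : K [x] = Φ x := by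
  have h := hK [x]
  rw [stackMoment_nil_cons, stackMoment_cons_nil, hK] at h
  simpa [hΦ] using h

/-- In the moment of `x :: w`, the terms where `x` is not a singleton form a covariance. Identities
between cumulants can then be tested on covariances by `eq_zero_of_stackMoment_eq_zero`. -/
theorem stackMoment_cumulant_cons (hΦ : Φ 1 = 1) (hK : ∀ w, stackMoment K [] w = Φ w.prod)
    (x : 𝒜) (w : List 𝒜) :
    stackMoment K [fun v => K (x :: v)] w = Φ (x * w.prod) - Φ x * Φ w.prod := by
  have h := hK (x :: w)
  rw [stackMoment_nil_cons, hK, cumulant_singleton_eq hΦ hK, List.prod_cons] at h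
  linear_combination h

/-- Adding a scalar to the first argument does not change a cumulant of order at least two. -/
theorem cumulant_sub_smul_one_cons (hΦ : Φ 1 = 1) (hK : ∀ w, stackMoment K [] w = Φ w.prod)
    (b : 𝒜) (c : R) (v : List 𝒜) (hv : v ≠ []) : K ((b - c • 1) :: v) = K (b :: v) := by
  have h := eq_zero_of_stackMoment_eq_zero (K := K)
    (f := (fun v => K ((b - c • 1) :: v)) + (-1 : R) • fun v => K (b :: v)) (fun w => ?_) v hv
  · simp only [Pi.add_apply, Pi.smul_apply, smul_eq_mul] at h
    linear_combination h
  · have h1 := stackMoment_add (K := K) w [] (fun v => K ((b - c • 1) :: v))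
      ((-1 : R) • fun v => K (b :: v)) []
    have h2 := stackMoment_smul (K := K) (-1) w [] (fun v => K (b :: v)) []
    simp only [List.nil_append] at h1 h2
    -- A covariance does not change when a scalar is added to its first argument.
    rw [h1, h2, stackMoment_cumulant_cons hΦ hK, stackMoment_cumulant_cons hΦ hK]
    simp only [sub_mul, smul_mul_assoc, one_mul, map_sub, map_smul, smul_eq_mul, hΦ]
    ring

/-- The formula for cumulants with a product as first argument. -/
theorem cumulant_mul_cons (hΦ : Φ 1 = 1) (hK : ∀ w, stackMoment K [] w = Φ w.prod)
    (a b : 𝒜) (v : List 𝒜) (hv : v ≠ []) :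
    K (a * b :: v) = K (a :: b :: v) + Φ a * K (b :: v) + Φ b * K (a :: v) +
      splitSum (fun u => K (b :: u)) (fun u => K (a :: u)) v := by
  set f₁ : List 𝒜 → R := fun v => K (a :: b :: v) with hf₁
  set f₂ : List 𝒜 → R := fun v => K (b :: v) with hf₂
  set f₃ : List 𝒜 → R := fun v => K (a :: v) with hf₃
  set f₄ : List 𝒜 → R := fun v => K (a * b :: v) with hf₄
  have h := eq_zero_of_stackMoment_eq_zero (K := K)
    (f := f₁ + (Φ a • f₂ + (Φ b • f₃ + (splitSum f₂ f₃ + (-1 : R) • f₄)))) (fun w => ?_) v hv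
  · simp only [Pi.add_apply, Pi.smul_apply, smul_eq_mul] at h
    simp only [hf₁, hf₂, hf₃, hf₄] at h ⊢
    linear_combination -h
  · have A := fun f g : List 𝒜 → R => stackMoment_add (K := K) w [] f g []
    have S := fun (c : R) (f : List 𝒜 → R) => stackMoment_smul (K := K) c w [] f []
    have C := stackMoment_splitSum (K := K) w [] f₂ f₃ []
    simp only [List.nil_append] at A S C
    rw [A, A, A, A, S, S, S, C]
    -- `e₁` expands the covariance of `a` with `b` times the rest according to the role of `b`:
    -- singleton, new block, continuing or closing the block of `a`. The word `[b]` in `e₅`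
    -- evaluates `K [a, b]`.
    have e₁ := stackMoment_cumulant_cons hΦ hK a (b :: w)
    rw [stackMoment_cons_cons, cumulant_singleton_eq hΦ hK, hK] at e₁
    have e₂ := stackMoment_cumulant_cons hΦ hK b w
    have e₃ := stackMoment_cumulant_cons hΦ hK a w
    have e₄ := stackMoment_cumulant_cons hΦ hK (a * b) w
    have e₅ := stackMoment_cumulant_cons hΦ hK a [b]
    rw [stackMoment_cons_cons, stackMoment_cons_nil, stackMoment_cons_nil, stackMoment_cons_nil,
      stackMoment_nil_nil] at e₅
    simp only [List.prod_cons, List.prod_nil, mul_one, mul_zero, zero_add] at e₁ e₅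
    rw [e₅] at e₁
    rw [e₂, e₃, e₄]
    rw [e₃] at e₁
    simp only [mul_assoc] at e₁ ⊢
    linear_combination e₁

/-- In one colour this is `cumulant_mul_cons`. Otherwise a letter of another colour kills every
term; in a split it lies in one of the two factors. -/
theorem monochromaticCumulant_mul_cons (hΦ : Φ 1 = 1) (hK : ∀ w, stackMoment K [] w = Φ w.prod)
    (i : ι) (a b : 𝒜) (v : List (ι × 𝒜)) (hv : v ≠ []) :
    monochromaticCumulant K ((i, a * b) :: v) =
      monochromaticCumulant K ((i, a) :: (i, b) :: v) + Φ a * monochromaticCumulant K ((i, b) :: v)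
        + Φ b * monochromaticCumulant K ((i, a) :: v) +
        splitSum (fun u => monochromaticCumulant K ((i, b) :: u))
          (fun u => monochromaticCumulant K ((i, a) :: u)) v := by
  by_cases h : ∀ y ∈ v, y.1 = i
  · rw [monochromaticCumulant_of_forall h, monochromaticCumulant_of_forall (by simpa using h),
      monochromaticCumulant_of_forall h, monochromaticCumulant_of_forall h,
      splitSum_map Prod.snd v _ _ (fun u => K (b :: u)) (fun u => K (a :: u))]
    · exact cumulant_mul_cons hΦ hK a b _ (by simpa using hv)
    · rintro v₁ v₂ rfl _ _
      exact ⟨monochromaticCumulant_of_forall fun y hy => h y (by simp [hy]),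
        monochromaticCumulant_of_forall fun y hy => h y (by simp [hy])⟩
  · push Not at h
    obtain ⟨y, hy, hne⟩ := h
    rw [monochromaticCumulant_eq_zero hy hne,
      monochromaticCumulant_eq_zero (y := y) (by simp [hy]) hne,
      monochromaticCumulant_eq_zero hy hne, monochromaticCumulant_eq_zero hy hne,
      splitSum_eq_zero]
    · ring
    · rintro v₁ v₂ rfl _ _
      rcases List.mem_append.mp hy with hy | hy
      · rw [monochromaticCumulant_eq_zero hy hne, zero_mul]
      · rw [monochromaticCumulant_eq_zero hy hne, mul_zero]

theorem monochromaticCumulant_sub_smul_one_cons (hΦ : Φ 1 = 1)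
    (hK : ∀ w, stackMoment K [] w = Φ w.prod) (i : ι) (b : 𝒜) (c : R) (v : List (ι × 𝒜))
    (hv : v ≠ []) : monochromaticCumulant K ((i, b - c • 1) :: v) =
      monochromaticCumulant K ((i, b) :: v) := by
  by_cases h : ∀ y ∈ v, y.1 = i
  · rw [monochromaticCumulant_of_forall h, monochromaticCumulant_of_forall h]
    exact cumulant_sub_smul_one_cons hΦ hK b c _ (by simpa using hv)
  · push Not at h
    obtain ⟨y, hy, hne⟩ := h
    rw [monochromaticCumulant_eq_zero hy hne, monochromaticCumulant_eq_zero hy hne]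

/-- A word of centred elements of the algebras `B i`, neighbours having different colours. -/
structure IsCentredAlternating (Φ : 𝒜 →ₗ[R] R) (B : ι → Subalgebra R 𝒜)
    (c : List (ι × 𝒜)) : Prop where
  chain : c.IsChain fun x y => x.1 ≠ y.1
  mem : ∀ x ∈ c, x.2 ∈ B x.1
  centred : ∀ x ∈ c, Φ x.2 = 0

theorem IsCentredAlternating.cons {B : ι → Subalgebra R 𝒜} {c : List (ι × 𝒜)}
    (hc : IsCentredAlternating Φ B c) {x : ι × 𝒜} (hx : x.2 ∈ B x.1) (h0 : Φ x.2 = 0)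
    (hne : ∀ y ∈ c.head?, x.1 ≠ y.1) : IsCentredAlternating Φ B (x :: c) where
  chain := List.isChain_cons.mpr ⟨hne, hc.chain⟩
  mem := by simpa using ⟨hx, fun a b h => hc.mem _ h⟩
  centred := by simpa using ⟨h0, fun a b h => hc.centred _ h⟩

theorem IsCentredAlternating.tail {B : ι → Subalgebra R 𝒜} {x : ι × 𝒜} {c : List (ι × 𝒜)}
    (hc : IsCentredAlternating Φ B (x :: c)) : IsCentredAlternating Φ B c where
  chain := (List.isChain_cons.mp hc.chain).2
  mem := fun y hy => hc.mem y (by simp [hy])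
  centred := fun y hy => hc.centred y (by simp [hy])

/-- A letter whose colour differs from the top of the stack cannot join the top block, so it is a
singleton or opens a block. In the latter case another letter follows in the block, and the opening
letter may be centred for free. -/
theorem stackMoment_letterStack_cons_of_ne (hΦ : Φ 1 = 1)
    (hK : ∀ w, stackMoment K [] w = Φ w.prod) {c : List (ι × 𝒜)} {i : ι} (b : 𝒜)
    (hne : ∀ y ∈ c.head?, i ≠ y.1) (w : List (ι × 𝒜)) :
    stackMoment (monochromaticCumulant K) (letterStack K c) ((i, b) :: w) =
      Φ b * stackMoment (monochromaticCumulant K) (letterStack K c) w +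
        stackMoment (monochromaticCumulant K) (letterStack K ((i, b - Φ b • 1) :: c)) w := by
  have h1 := stackMoment_congr (K := monochromaticCumulant K) w [] (letterStack K c)
    (f := fun v => monochromaticCumulant K ((i, b - Φ b • 1) :: v))
    (g := fun v => monochromaticCumulant K ((i, b) :: v))
    fun v hv _ => monochromaticCumulant_sub_smul_one_cons hΦ hK i b _ v hv
  simp only [List.nil_append] at h1
  rw [letterStack_cons, h1]
  cases c with
  | nil =>
    rw [letterStack, List.map_nil, stackMoment_nil_cons, monochromaticCumulant_singleton,
      cumulant_singleton_eq hΦ hK]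
  | cons y c =>
    have hy : i ≠ y.1 := hne y (by simp)
    have h2 := stackMoment_eq_zero (K := monochromaticCumulant K) w []
      (fun v => monochromaticCumulant K (y :: (i, b) :: v)) (letterStack K c)
      fun v _ _ => monochromaticCumulant_eq_zero (y := (i, b)) (by simp) hy
    simp only [List.nil_append] at h2
    rw [letterStack_cons, stackMoment_cons_cons, monochromaticCumulant_singleton,
      cumulant_singleton_eq hΦ hK, h2,
      monochromaticCumulant_eq_zero (x := y) (y := (i, b)) (by simp) hy]
    ring

/-- If `b` closes the block of `a`, the factor is `K [a, b] = Φ (a * b)`. The other three roles of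
`b` add up, by the product formula with `Φ a = 0`, to an open block with first letter `a * b`; the
split sum accounts for `b` opening a block above that of `a`. -/
theorem stackMoment_letterStack_cons_of_eq (hΦ : Φ 1 = 1)
    (hK : ∀ w, stackMoment K [] w = Φ w.prod) {c : List (ι × 𝒜)} {i : ι} (a b : 𝒜) (ha : Φ a = 0)
    (w : List (ι × 𝒜)) :
    stackMoment (monochromaticCumulant K) (letterStack K ((i, a) :: c)) ((i, b) :: w) =
      Φ (a * b) * stackMoment (monochromaticCumulant K) (letterStack K c) w +
        stackMoment (monochromaticCumulant K)
          (letterStack K ((i, a * b - Φ (a * b) • 1) :: c)) w := by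
  set L := monochromaticCumulant (ι := ι) K with hL
  have h1 := stackMoment_congr (K := L) w [] (letterStack K c)
    (f := fun v => L ((i, a * b - Φ (a * b) • 1) :: v))
    (g := (fun v => L ((i, a) :: (i, b) :: v)) + (Φ b • (fun v => L ((i, a) :: v)) +
      splitSum (fun u => L ((i, b) :: u)) (fun u => L ((i, a) :: u))))
    fun v hv _ => by
      simp only [hL, Pi.add_apply, Pi.smul_apply, smul_eq_mul]
      rw [monochromaticCumulant_sub_smul_one_cons hΦ hK i _ _ v hv,
        monochromaticCumulant_mul_cons hΦ hK i a b v hv, ha]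
      ring
  have A := fun f g : List (ι × 𝒜) → R => stackMoment_add (K := L) w [] f g (letterStack K c)
  have S := fun (r : R) (f : List (ι × 𝒜) → R) =>
    stackMoment_smul (K := L) r w [] f (letterStack K c)
  have C := stackMoment_splitSum (K := L) w [] (fun u => L ((i, b) :: u))
    (fun u => L ((i, a) :: u)) (letterStack K c)
  simp only [List.nil_append] at h1 A S C
  have hab : L [(i, a), (i, b)] = Φ (a * b) := by
    rw [hL, monochromaticCumulant_of_forall (by simp)]
    have h := hK [a, b]
    rw [stackMoment_nil_cons, stackMoment_cons_cons, stackMoment_cons_nil, stackMoment_cons_nil,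
      stackMoment_cons_nil, stackMoment_nil_nil, cumulant_singleton_eq hΦ hK, ha] at h
    simpa using h
  have hb : L [(i, b)] = Φ b := by
    rw [hL, monochromaticCumulant_singleton, cumulant_singleton_eq hΦ hK]
  rw [letterStack_cons, letterStack_cons, ← hL, h1, A, A, S, C, stackMoment_cons_cons, hab, hb]
  ring

/-- The stack `c` is the reduced form of the part already read, innermost letter first. A new letter
is split into its mean and its centred part, after multiplication with the top letter if the colours
agree; both sides follow this recursion. When `w` is exhausted and `c` is nonempty, the left side
vanishes because blocks remain open, the right side by freeness. -/
theorem stackMoment_letterStack (hΦ : Φ 1 = 1) (hK : ∀ w, stackMoment K [] w = Φ w.prod)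
    {B : ι → Subalgebra R 𝒜}
    (hfree : ∀ c : List (ι × 𝒜), c ≠ [] → IsCentredAlternating Φ B c →
      Φ (c.reverse.map Prod.snd).prod = 0)
    (w : List (ι × 𝒜)) : ∀ c : List (ι × 𝒜), (∀ x ∈ w, x.2 ∈ B x.1) →
    IsCentredAlternating Φ B c →
    stackMoment (monochromaticCumulant K) (letterStack K c) w =
      Φ ((c.reverse.map Prod.snd).prod * (w.map Prod.snd).prod) := by
  induction w with
  | nil =>
    intro c _ hc
    cases c with
    | nil => simp [letterStack, stackMoment_nil_nil, hΦ]
    | cons y c =>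
      rw [letterStack_cons, stackMoment_cons_nil, List.map_nil, List.prod_nil, mul_one,
        hfree _ (by simp) hc]
  | cons x w ih =>
    intro c hw hc
    obtain ⟨i, b⟩ := x
    have hb : b ∈ B i := hw (i, b) (by simp)
    have hw' : ∀ x ∈ w, x.2 ∈ B x.1 := fun x hx => hw x (by simp [hx])
    have centre : ∀ z : 𝒜, Φ (z - Φ z • 1) = 0 := fun z => by simp [hΦ]
    have centre_mem : ∀ z ∈ B i, z - Φ z • 1 ∈ B i := fun z hz =>
      sub_mem hz ((B i).smul_mem (one_mem _) _)
    by_cases hne : ∀ y ∈ c.head?, i ≠ y.1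
    · rw [stackMoment_letterStack_cons_of_ne hΦ hK b hne, ih c hw' hc,
        ih _ hw' (hc.cons (x := (i, b - Φ b • 1)) (centre_mem b hb) (centre b) hne)]
      simp only [List.reverse_cons, List.map_append, List.map_cons, List.map_nil, List.prod_append,
        List.prod_cons, List.prod_nil, mul_one, mul_sub, sub_mul, mul_smul_comm, smul_mul_assoc,
        map_sub, map_smul, smul_eq_mul, mul_assoc]
      ring
    · push Not at hne
      obtain ⟨y, hy, rfl⟩ := hne
      cases c with
      | nil => simp at hy
      | cons y' c =>
        obtain rfl : y' = y := by simpa using hy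
        obtain ⟨i, a⟩ := y'
        have ha : Φ a = 0 := hc.centred (i, a) (by simp)
        have hab : a * b ∈ B i := mul_mem (hc.mem (i, a) (by simp)) hb
        rw [stackMoment_letterStack_cons_of_eq hΦ hK a b ha, ih c hw' hc.tail,
          ih _ hw' (hc.tail.cons (x := (i, a * b - Φ (a * b) • 1)) (centre_mem _ hab) (centre _)
            (List.isChain_cons.mp hc.chain).1)]
        simp only [List.reverse_cons, List.map_append, List.map_cons, List.map_nil,
          List.prod_append, List.prod_cons, List.prod_nil, mul_one, mul_sub, sub_mul,
          mul_smul_comm, smul_mul_assoc, map_sub, map_smul, smul_eq_mul, mul_assoc]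
        ring

/-- Vanishing of mixed cumulants in free subalgebras. -/
theorem cumulant_eq_monochromaticCumulant (hΦ : Φ 1 = 1)
    (hK : ∀ w, stackMoment K [] w = Φ w.prod) {B : ι → Subalgebra R 𝒜}
    (hfree : ∀ c : List (ι × 𝒜), c ≠ [] → IsCentredAlternating Φ B c →
      Φ (c.reverse.map Prod.snd).prod = 0)
    (w : List (ι × 𝒜)) (hw : w ≠ []) (hB : ∀ x ∈ w, x.2 ∈ B x.1) :
    K (w.map Prod.snd) = monochromaticCumulant K w := by
  -- Uniqueness of cumulants compares all shorter words over the alphabet, so the alphabet is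
  -- restricted to letters lying in the subalgebra of their colour.
  lift w to List {x : ι × 𝒜 // x.2 ∈ B x.1} using hB
  induction hn : w.length using Nat.strong_induction_on generalizing w with
  | _ n ih =>
    have hw' : w ≠ [] := by simpa using hw
    have h := stackMoment_sub_stackMoment
      (K := fun v : List {x : ι × 𝒜 // x.2 ∈ B x.1} => K (v.map fun x => x.1.2))
      (K' := fun v => monochromaticCumulant K (v.map Subtype.val)) w hw' fun v hv hl => by
        rw [← ih v.length (hn ▸ hl) v (by simpa using hv) rfl, List.map_map]
        rfl
    have h1 := stackMoment_map K (fun x : {x : ι × 𝒜 // x.2 ∈ B x.1} => x.1.2) w []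
    have h2 := stackMoment_map (monochromaticCumulant K) (Subtype.val (p := fun x : ι × 𝒜 =>
      x.2 ∈ B x.1)) w []
    have h3 := stackMoment_letterStack hΦ hK hfree (w.map Subtype.val) []
      (by simp only [List.mem_map]; rintro _ ⟨x, _, rfl⟩; exact x.2) ⟨by simp, by simp, by simp⟩
    have e : (fun x : {x : ι × 𝒜 // x.2 ∈ B x.1} => x.1.2) = Prod.snd ∘ Subtype.val := rfl
    simp only [List.map_nil, letterStack, List.reverse_nil, List.prod_nil, one_mul, e,
      ← List.map_map] at h h1 h2 h3
    rw [h1, h2, h3, hK, sub_self] at h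
    exact sub_eq_zero.mp h.symm

end MixedCumulants

/-! ### Recursive decomposition of sums over non-crossing partitions. -/

section NonCrossingSums

variable {α R : Type*} [LinearOrder α] [CommRing R]

/-- `P` is the set of blocks of a non-crossing partition of `S`. -/
structure IsNCPartition (S : Finset α) (P : Finset (Finset α)) : Prop where
  nonempty : ∀ V ∈ P, V.Nonempty
  subset : ∀ V ∈ P, V ⊆ S
  cover : ∀ x ∈ S, ∃ V ∈ P, x ∈ V
  eq_of_mem : ∀ V ∈ P, ∀ W ∈ P, ∀ x, x ∈ V → x ∈ W → V = W
  nonCrossing : ∀ V ∈ P, ∀ W ∈ P, ∀ a b c d, a < b → b < c → c < d →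
    a ∈ V → c ∈ V → b ∈ W → d ∈ W → V = W

open Classical in
/-- The non-crossing partitions of `S`. -/
noncomputable def ncPartitions (S : Finset α) : Finset (Finset (Finset α)) :=
  S.powerset.powerset.filter (IsNCPartition S)

open Classical in
theorem mem_ncPartitions {S : Finset α} {P : Finset (Finset α)} :
    P ∈ ncPartitions S ↔ IsNCPartition S P := by
  rw [ncPartitions, Finset.mem_filter, Finset.mem_powerset, and_iff_right_iff_imp]
  exact fun h V hV => Finset.mem_powerset.mpr (h.subset V hV)

/-- The sum over the non-crossing partitions of `S` of the products of the weights of the blocks. -/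
noncomputable def ncSum (ω : Finset α → R) (S : Finset α) : R :=
  ∑ P ∈ ncPartitions S, ∏ V ∈ P, ω V

theorem ncSum_empty (ω : Finset α → R) : ncSum ω ∅ = 1 := by
  have h : ncPartitions (∅ : Finset α) = {∅} := by
    ext P
    rw [mem_ncPartitions, Finset.mem_singleton]
    constructor
    · intro h
      refine Finset.eq_empty_of_forall_notMem fun V hV => ?_
      obtain ⟨x, hx⟩ := h.nonempty V hV
      simpa using h.subset V hV hx
    · rintro rfl
      constructor <;> simp
  simp [ncSum, h]

theorem ncSum_congr {ω ω' : Finset α → R} {S : Finset α} (h : ∀ V ⊆ S, V.Nonempty → ω V = ω' V) :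
    ncSum ω S = ncSum ω' S := by
  refine Finset.sum_congr rfl fun P hP => Finset.prod_congr rfl fun V hV => ?_
  rw [mem_ncPartitions] at hP
  exact h V (hP.subset V hV) (hP.nonempty V hV)

variable {x y : α} {S : Finset α} {P P₁ P₂ : Finset (Finset α)}

theorem IsNCPartition.insert_singleton (hP : IsNCPartition S P) (h : ∀ z ∈ S, x < z) :
    IsNCPartition (insert x S) (insert {x} P) where
  nonempty := by
    have := hP.nonempty
    simpa using this
  subset V hV z hz := by
    rcases Finset.mem_insert.mp hV with rfl | hV
    · simp [Finset.mem_singleton.mp hz]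
    · exact Finset.mem_insert_of_mem (hP.subset V hV hz)
  cover z hz := by
    rcases Finset.mem_insert.mp hz with rfl | hz
    · exact ⟨{z}, by simp, by simp⟩
    · obtain ⟨V, hV, hzV⟩ := hP.cover z hz
      exact ⟨V, Finset.mem_insert_of_mem hV, hzV⟩
  eq_of_mem V hV W hW z hzV hzW := by
    rcases Finset.mem_insert.mp hV with rfl | hV <;> rcases Finset.mem_insert.mp hW with rfl | hW
    · rfl
    · exact absurd (Finset.mem_singleton.mp hzV) (h z (hP.subset W hW hzW)).ne'
    · exact absurd (Finset.mem_singleton.mp hzW) (h z (hP.subset V hV hzV)).ne'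
    · exact hP.eq_of_mem V hV W hW z hzV hzW
  nonCrossing V hV W hW a b c d hab hbc hcd haV hcV hbW hdW := by
    rcases Finset.mem_insert.mp hV with rfl | hV
    · rw [Finset.mem_singleton] at haV hcV
      exact absurd (hab.trans hbc) (by simp [haV, hcV])
    · rcases Finset.mem_insert.mp hW with rfl | hW
      · rw [Finset.mem_singleton] at hbW hdW
        exact absurd (hbc.trans hcd) (by simp [hbW, hdW])
      · exact hP.nonCrossing V hV W hW a b c d hab hbc hcd haV hcV hbW hdW

theorem IsNCPartition.erase_singleton (hx : x ∉ S) (hP : IsNCPartition (insert x S) P)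
    (h : {x} ∈ P) : IsNCPartition S (P.erase {x}) where
  nonempty V hV := hP.nonempty V (Finset.mem_of_mem_erase hV)
  subset V hV z hz := by
    obtain ⟨hne, hVP⟩ := Finset.mem_erase.mp hV
    refine (Finset.mem_insert.mp (hP.subset V hVP hz)).resolve_left ?_
    rintro rfl
    exact hne (hP.eq_of_mem V hVP _ h z hz (by simp))
  cover z hz := by
    obtain ⟨V, hV, hzV⟩ := hP.cover z (Finset.mem_insert_of_mem hz)
    refine ⟨V, Finset.mem_erase.mpr ⟨?_, hV⟩, hzV⟩
    rintro rfl
    exact hx (Finset.mem_singleton.mp hzV ▸ hz)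
  eq_of_mem V hV W hW :=
    hP.eq_of_mem V (Finset.mem_of_mem_erase hV) W (Finset.mem_of_mem_erase hW)
  nonCrossing V hV W hW :=
    hP.nonCrossing V (Finset.mem_of_mem_erase hV) W (Finset.mem_of_mem_erase hW)

theorem sum_ncPartitions_singleton_mem (ω : Finset α → R) (h : ∀ z ∈ S, x < z) :
    ∑ P ∈ ncPartitions (insert x S) with {x} ∈ P, ∏ V ∈ P, ω V = ω {x} * ncSum ω S := by
  have hx : x ∉ S := fun hx => lt_irrefl _ (h x hx)
  have hP : ∀ P ∈ ncPartitions S, {x} ∉ P := fun P hP hm =>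
    hx ((mem_ncPartitions.mp hP).subset _ hm (Finset.mem_singleton_self x))
  rw [ncSum, Finset.mul_sum]
  refine Finset.sum_nbij' (fun P => P.erase {x}) (fun P => insert {x} P) ?_ ?_ ?_ ?_ ?_
  · intro P hP
    rw [Finset.mem_filter, mem_ncPartitions] at hP
    exact mem_ncPartitions.mpr (hP.1.erase_singleton hx hP.2)
  · intro P hP
    rw [Finset.mem_filter, mem_ncPartitions]
    exact ⟨(mem_ncPartitions.mp hP).insert_singleton h, Finset.mem_insert_self _ _⟩
  · intro P hP
    exact Finset.insert_erase (Finset.mem_filter.mp hP).2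
  · intro P hm
    exact Finset.erase_insert (hP P hm)
  · intro P hP
    exact (Finset.mul_prod_erase P ω (Finset.mem_filter.mp hP).2).symm

/-- Adds `x` to the sets which contain `y`. -/
def attach (x y : α) (V : Finset α) : Finset α := if y ∈ V then insert x V else V

theorem mem_attach {z : α} {V : Finset α} : z ∈ attach x y V ↔ z ∈ V ∨ (z = x ∧ y ∈ V) := by
  unfold attach
  split_ifs with h <;> simp [h, or_comm]

theorem erase_attach {V : Finset α} (hV : x ∉ V) : (attach x y V).erase x = V := by
  ext z
  rw [Finset.mem_erase, mem_attach]
  grind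

/-- `x` is in the same block as `y`, and nothing lies between `x` and `y` in this block. -/
def IsNextInBlock (x y : α) (P : Finset (Finset α)) : Prop :=
  ∃ V ∈ P, x ∈ V ∧ y ∈ V ∧ ∀ z ∈ V, z ≠ x → y ≤ z

/-- The blocks in the gap between `x` and `y` are separated from the rest, and the minimum `x`
behaves like a copy of `y`: a crossing that uses `x` would already be one with `y`. -/
theorem isNCPartition_union (h : ∀ z ∈ S, x < z) (hy : y ∈ S)
    (h₁ : IsNCPartition (S.filter (· < y)) P₁) (h₂ : IsNCPartition (S.filter (y ≤ ·)) P₂) :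
    IsNCPartition (insert x S) (P₁ ∪ P₂.image (attach x y)) := by
  have s₁ : ∀ V ∈ P₁, ∀ z ∈ V, z ∈ S ∧ z < y := fun V hV z hz => by
    simpa using h₁.subset V hV hz
  have s₂ : ∀ V ∈ P₂, ∀ z ∈ V, z ∈ S ∧ y ≤ z := fun V hV z hz => by
    simpa using h₂.subset V hV hz
  constructor
  · intro V hV
    rcases Finset.mem_union.mp hV with hV | hV
    · exact h₁.nonempty V hV
    · obtain ⟨W, hW, rfl⟩ := Finset.mem_image.mp hV
      obtain ⟨z, hz⟩ := h₂.nonempty W hW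
      exact ⟨z, mem_attach.mpr (Or.inl hz)⟩
  · intro V hV z hz
    rcases Finset.mem_union.mp hV with hV | hV
    · exact Finset.mem_insert_of_mem (s₁ V hV z hz).1
    · obtain ⟨W, hW, rfl⟩ := Finset.mem_image.mp hV
      rcases mem_attach.mp hz with hz | hz
      · exact Finset.mem_insert_of_mem (s₂ W hW z hz).1
      · simp [hz.1]
  · intro z hz
    rcases Finset.mem_insert.mp hz with rfl | hz
    · obtain ⟨V, hV, hyV⟩ := h₂.cover y (by simp [hy])
      exact ⟨attach z y V, Finset.mem_union_right _ (Finset.mem_image_of_mem _ hV), mem_attach.mpr (Or.inr ⟨rfl, hyV⟩)⟩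
    · rcases lt_or_ge z y with hzy | hzy
      · obtain ⟨V, hV, hzV⟩ := h₁.cover z (by simp [hz, hzy])
        exact ⟨V, by simp [hV], hzV⟩
      · obtain ⟨V, hV, hzV⟩ := h₂.cover z (by simp [hz, hzy])
        exact ⟨attach x y V, Finset.mem_union_right _ (Finset.mem_image_of_mem _ hV), mem_attach.mpr (Or.inl hzV)⟩
  · intro V hV W hW z hzV hzW
    have e₁ := h₁.eq_of_mem
    have e₂ := h₂.eq_of_mem
    simp only [Finset.mem_union, Finset.mem_image] at hV hW
    rcases hV with hV | ⟨V, hV, rfl⟩ <;> rcases hW with hW | ⟨W, hW, rfl⟩ 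
    · exact e₁ V hV W hW z hzV hzW
    · rw [mem_attach] at hzW
      grind
    · rw [mem_attach] at hzV
      grind
    · rw [mem_attach] at hzV hzW
      congr 1
      grind
  · intro V hV W hW a b c d hab hbc hcd haV hcV hbW hdW
    simp only [Finset.mem_union, Finset.mem_image] at hV hW
    rcases hV with hV | ⟨V, hV, rfl⟩ <;> rcases hW with hW | ⟨W, hW, rfl⟩ 
    · exact h₁.nonCrossing V hV W hW a b c d hab hbc hcd haV hcV hbW hdW
    · rw [mem_attach] at hbW hdW
      grind
    · rw [mem_attach] at haV hcV
      grind
    · rw [mem_attach] at haV hcV hbW hdW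
      congr 1
      -- Only `a` can equal the added point: `b`, `c`, `d` exceed `x`, hence come from the original
      -- blocks.
      have hxa : x ≤ a := by grind
      have hb : b ∈ W := by grind
      have hc : c ∈ V := by grind
      have hd : d ∈ W := by grind
      rcases haV with ha | ⟨rfl, ha⟩
      · exact h₂.nonCrossing V hV W hW a b c d hab hbc hcd ha hc hb hd
      · rcases (s₂ W hW b hb).2.eq_or_lt with rfl | hyb
        · exact h₂.eq_of_mem V hV W hW _ ha hb
        · exact h₂.nonCrossing V hV W hW y b c d hyb hbc hcd ha hc hb hd

/-- A block with a point `z` in the gap and a point `u` beyond `y` would cross the block of `x` and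
`y` at `x < z < y < u`. -/
theorem IsNCPartition.subset_of_isNext (h : ∀ z ∈ S, x < z)
    (hP : IsNCPartition (insert x S) P) (hxy : IsNextInBlock x y P) {V : Finset α} (hV : V ∈ P)
    {z : α} (hz : z ∈ V) (hzx : z ≠ x) (hzy : z < y) : V ⊆ S.filter (· < y) := by
  obtain ⟨B, hB, hxB, hyB, hmin⟩ := hxy
  have hVB : V ≠ B := by
    rintro rfl
    exact absurd (hmin z hz hzx) (not_le.mpr hzy)
  intro u hu
  have hux : u ≠ x := by
    rintro rfl
    exact hVB (hP.eq_of_mem V hV B hB _ hu hxB)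
  have huS : u ∈ S := (Finset.mem_insert.mp (hP.subset V hV hu)).resolve_left hux
  have hzS : z ∈ S := (Finset.mem_insert.mp (hP.subset V hV hz)).resolve_left hzx
  refine Finset.mem_filter.mpr ⟨huS, ?_⟩
  by_contra hlt
  rcases (not_lt.mp hlt).eq_or_lt with rfl | hyu
  · exact hVB (hP.eq_of_mem V hV B hB _ hu hyB)
  · exact hVB (hP.nonCrossing B hB V hV x z y u (h z hzS) hzy hyu hxB hyB hz hu).symm

theorem IsNCPartition.filter_subset_of_isNext (h : ∀ z ∈ S, x < z)
    (hP : IsNCPartition (insert x S) P) (hxy : IsNextInBlock x y P) :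
    IsNCPartition (S.filter (· < y)) (P.filter (· ⊆ S.filter (· < y))) where
  nonempty V hV := hP.nonempty V (Finset.mem_filter.mp hV).1
  subset V hV := (Finset.mem_filter.mp hV).2
  cover z hz := by
    obtain ⟨hzS, hzy⟩ := Finset.mem_filter.mp hz
    obtain ⟨V, hV, hzV⟩ := hP.cover z (by simp [hzS])
    exact ⟨V, Finset.mem_filter.mpr
      ⟨hV, hP.subset_of_isNext h hxy hV hzV (h z hzS).ne' hzy⟩, hzV⟩
  eq_of_mem V hV W hW := hP.eq_of_mem V (Finset.mem_filter.mp hV).1 W (Finset.mem_filter.mp hW).1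
  nonCrossing V hV W hW :=
    hP.nonCrossing V (Finset.mem_filter.mp hV).1 W (Finset.mem_filter.mp hW).1

theorem IsNCPartition.image_erase_of_isNext (h : ∀ z ∈ S, x < z) (hy : y ∈ S)
    (hP : IsNCPartition (insert x S) P) (hxy : IsNextInBlock x y P) :
    IsNCPartition (S.filter (y ≤ ·))
      ((P.filter (¬ · ⊆ S.filter (· < y))).image (·.erase x)) := by
  have key : ∀ V ∈ P, ¬ V ⊆ S.filter (· < y) → ∀ z ∈ V, z ≠ x → z ∈ S ∧ y ≤ z := by
    intro V hV hn z hz hzx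
    refine ⟨(Finset.mem_insert.mp (hP.subset V hV hz)).resolve_left hzx, ?_⟩
    by_contra hlt
    exact hn (hP.subset_of_isNext h hxy hV hz hzx (not_le.mp hlt))
  constructor
  · intro V hV
    simp only [Finset.mem_image, Finset.mem_filter] at hV
    obtain ⟨W, ⟨hW, hn⟩, rfl⟩ := hV
    obtain ⟨B, hB, hxB, hyB, _⟩ := hxy
    by_cases hxW : x ∈ W
    · rw [hP.eq_of_mem W hW B hB x hxW hxB]
      exact ⟨y, Finset.mem_erase.mpr ⟨(h y hy).ne', hyB⟩⟩
    · rw [Finset.erase_eq_of_notMem hxW]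
      exact hP.nonempty W hW
  · intro V hV z hz
    simp only [Finset.mem_image, Finset.mem_filter] at hV
    obtain ⟨W, ⟨hW, hn⟩, rfl⟩ := hV
    exact Finset.mem_filter.mpr (key W hW hn z (Finset.mem_of_mem_erase hz)
      (Finset.ne_of_mem_erase hz))
  · intro z hz
    obtain ⟨hzS, hyz⟩ := Finset.mem_filter.mp hz
    obtain ⟨V, hV, hzV⟩ := hP.cover z (by simp [hzS])
    refine ⟨V.erase x, Finset.mem_image.mpr ⟨V, Finset.mem_filter.mpr ⟨hV, fun hs => ?_⟩, rfl⟩,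
      Finset.mem_erase.mpr ⟨(h z hzS).ne', hzV⟩⟩
    exact absurd (Finset.mem_filter.mp (hs hzV)).2 (not_lt.mpr hyz)
  · intro V hV W hW z hzV hzW
    simp only [Finset.mem_image, Finset.mem_filter] at hV hW
    obtain ⟨V, ⟨hV, _⟩, rfl⟩ := hV
    obtain ⟨W, ⟨hW, _⟩, rfl⟩ := hW
    rw [hP.eq_of_mem V hV W hW z (Finset.mem_of_mem_erase hzV) (Finset.mem_of_mem_erase hzW)]
  · intro V hV W hW a b c d hab hbc hcd haV hcV hbW hdW
    simp only [Finset.mem_image, Finset.mem_filter] at hV hW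
    obtain ⟨V, ⟨hV, _⟩, rfl⟩ := hV
    obtain ⟨W, ⟨hW, _⟩, rfl⟩ := hW
    rw [hP.nonCrossing V hV W hW a b c d hab hbc hcd (Finset.mem_of_mem_erase haV)
      (Finset.mem_of_mem_erase hcV) (Finset.mem_of_mem_erase hbW) (Finset.mem_of_mem_erase hdW)]

-- The partitions in question correspond to pairs: the blocks inside the gap below `y`, and the
-- remaining blocks with `x` erased. Attaching `x` to the block of `y` inverts this.
open Classical in
theorem sum_ncPartitions_isNext (ω : Finset α → R) (h : ∀ z ∈ S, x < z) (hy : y ∈ S) :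
    ∑ P ∈ ncPartitions (insert x S) with IsNextInBlock x y P, ∏ V ∈ P, ω V =
      ncSum ω (S.filter (· < y)) * ncSum (fun V => ω (attach x y V)) (S.filter (y ≤ ·)) := by
  have hx : x ∉ S := fun hx => lt_irrefl _ (h x hx)
  have hxmem : ∀ P ∈ ncPartitions (S.filter (y ≤ ·)), ∀ V ∈ P, x ∉ V := fun P hP V hV hxV =>
    hx (Finset.mem_filter.mp ((mem_ncPartitions.mp hP).subset V hV hxV)).1
  have hle : ∀ P ∈ ncPartitions (S.filter (y ≤ ·)), ∀ V ∈ P, ¬ attach x y V ⊆ S.filter (· < y) := by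
    intro P hP V hV hs
    obtain ⟨z, hz⟩ := (mem_ncPartitions.mp hP).nonempty V hV
    have h1 := (Finset.mem_filter.mp ((mem_ncPartitions.mp hP).subset V hV hz)).2
    have h2 := (Finset.mem_filter.mp (hs (mem_attach.mpr (Or.inl hz)))).2
    exact absurd h1 (not_le.mpr h2)
  rw [ncSum, ncSum, Finset.sum_mul_sum, ← Finset.sum_product']
  symm
  refine Finset.sum_nbij' (fun Q => Q.1 ∪ Q.2.image (attach x y))
    (fun P => (P.filter (· ⊆ S.filter (· < y)),
      (P.filter (¬ · ⊆ S.filter (· < y))).image (·.erase x))) ?_ ?_ ?_ ?_ ?_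
  · rintro ⟨P₁, P₂⟩ hQ
    rw [Finset.mem_product, mem_ncPartitions, mem_ncPartitions] at hQ
    rw [Finset.mem_filter, mem_ncPartitions]
    refine ⟨isNCPartition_union h hy hQ.1 hQ.2, ?_⟩
    obtain ⟨V, hV, hyV⟩ := hQ.2.cover y (by simp [hy])
    refine ⟨attach x y V, Finset.mem_union_right _ (Finset.mem_image_of_mem _ hV),
      mem_attach.mpr (Or.inr ⟨rfl, hyV⟩), mem_attach.mpr (Or.inl hyV), fun z hz hzx => ?_⟩
    exact (Finset.mem_filter.mp (hQ.2.subset V hV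
      ((mem_attach.mp hz).resolve_right fun hz => hzx hz.1))).2
  · intro P hP
    rw [Finset.mem_filter, mem_ncPartitions] at hP
    rw [Finset.mem_product, mem_ncPartitions, mem_ncPartitions]
    exact ⟨hP.1.filter_subset_of_isNext h hP.2, hP.1.image_erase_of_isNext h hy hP.2⟩
  · rintro ⟨P₁, P₂⟩ hQ
    rw [Finset.mem_product] at hQ
    have h₁ := (mem_ncPartitions.mp hQ.1).subset
    have hle' := hle P₂ hQ.2
    have hx' := hxmem P₂ hQ.2
    have f₁ : (P₁ ∪ P₂.image (attach x y)).filter (· ⊆ S.filter (· < y)) = P₁ := by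
      ext V
      simp only [Finset.mem_filter, Finset.mem_union, Finset.mem_image]
      constructor
      · rintro ⟨hV | ⟨W, hW, rfl⟩, hs⟩
        · exact hV
        · exact absurd hs (hle' W hW)
      · exact fun hV => ⟨Or.inl hV, h₁ V hV⟩
    have f₂ : (P₁ ∪ P₂.image (attach x y)).filter (¬ · ⊆ S.filter (· < y)) =
        P₂.image (attach x y) := by
      ext V
      simp only [Finset.mem_filter, Finset.mem_union, Finset.mem_image]
      constructor
      · rintro ⟨hV | hV, hs⟩
        · exact absurd (h₁ V hV) hs
        · exact hV
      · rintro ⟨W, hW, rfl⟩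
        exact ⟨Or.inr ⟨W, hW, rfl⟩, hle' W hW⟩
    simp only [f₁, f₂, Finset.image_image]
    congr 1
    conv_rhs => rw [← Finset.image_id (s := P₂)]
    exact Finset.image_congr fun V hV => erase_attach (hx' V hV)
  · intro P hP
    rw [Finset.mem_filter, mem_ncPartitions] at hP
    obtain ⟨hP, B, hB, hxB, hyB, -⟩ := hP
    have e : ∀ V ∈ P, attach x y (V.erase x) = V := by
      intro V hV
      by_cases hxV : x ∈ V
      · rw [hP.eq_of_mem V hV B hB x hxV hxB, attach,
          if_pos (Finset.mem_erase.mpr ⟨(h y hy).ne', hyB⟩), Finset.insert_erase hxB]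
      · have hyV : y ∉ V := fun hyV => hxV (hP.eq_of_mem V hV B hB y hyV hyB ▸ hxB)
        rw [Finset.erase_eq_of_notMem hxV, attach, if_neg hyV]
    simp only [Finset.image_image]
    have e' : (P.filter (¬ · ⊆ S.filter (· < y))).image (attach x y ∘ fun V => V.erase x) =
        P.filter (¬ · ⊆ S.filter (· < y)) := by
      conv_rhs => rw [← Finset.image_id (s := P.filter (¬ · ⊆ S.filter (· < y)))]
      exact Finset.image_congr fun V hV => e V (Finset.mem_filter.mp hV).1
    rw [e', Finset.filter_union_filter_not_eq]
  · rintro ⟨P₁, P₂⟩ hQ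
    rw [Finset.mem_product] at hQ
    have h₁ := (mem_ncPartitions.mp hQ.1).subset
    have hle' := hle P₂ hQ.2
    have hx' := hxmem P₂ hQ.2
    rw [Finset.prod_union, Finset.prod_image]
    · intro V hV W hW hVW
      rw [← erase_attach (y := y) (hx' V hV), ← erase_attach (y := y) (hx' W hW)]
      exact congrArg (·.erase x) hVW
    · rw [Finset.disjoint_left]
      intro V hV hV'
      obtain ⟨W, hW, rfl⟩ := Finset.mem_image.mp hV'
      exact hle' W hW (h₁ _ hV)

/-- The decomposition of a sum over non-crossing partitions according to the second element of the
block of the minimum. -/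
theorem ncSum_insert (ω : Finset α → R) (h : ∀ z ∈ S, x < z) :
    ncSum ω (insert x S) = ω {x} * ncSum ω S +
      ∑ y ∈ S, ncSum ω (S.filter (· < y)) *
        ncSum (fun V => ω (attach x y V)) (S.filter (y ≤ ·)) := by
  classical
  rw [ncSum, ← Finset.sum_filter_add_sum_filter_not _ (fun P => {x} ∈ P),
    sum_ncPartitions_singleton_mem ω h]
  congr 1
  rw [← Finset.sum_congr rfl fun y hy => sum_ncPartitions_isNext ω h hy, ← Finset.sum_biUnion]
  · refine Finset.sum_congr ?_ fun _ _ => rfl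
    ext P
    simp only [Finset.mem_filter, Finset.mem_biUnion, mem_ncPartitions]
    constructor
    · rintro ⟨hP, hn⟩
      obtain ⟨V, hV, hxV⟩ := hP.cover x (by simp)
      -- The required `y` is the least element of the block of `x` other than `x`; it exists since
      -- `{x}` is not a block.
      have hne : (V.erase x).Nonempty := by
        rw [Finset.nonempty_iff_ne_empty]
        intro he
        exact hn ((Finset.erase_eq_empty_iff V x).mp he |>.resolve_left
          (Finset.nonempty_iff_ne_empty.mp ⟨x, hxV⟩) ▸ hV)
      have hm := Finset.min'_mem _ hne
      refine ⟨(V.erase x).min' hne, ?_, hP, V, hV, hxV, Finset.mem_of_mem_erase hm, fun z hz hzx =>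
        Finset.min'_le _ _ (Finset.mem_erase.mpr ⟨hzx, hz⟩)⟩
      exact (Finset.mem_insert.mp (hP.subset V hV (Finset.mem_of_mem_erase hm))).resolve_left
        (Finset.ne_of_mem_erase hm)
    · rintro ⟨y, hy, hP, V, hV, hxV, hyV, -⟩
      refine ⟨hP, fun hx => (h y hy).ne' ?_⟩
      rw [hP.eq_of_mem V hV _ hx x hxV (by simp)] at hyV
      simpa using hyV
  · intro y hy y' hy' hne
    rw [Function.onFun, Finset.disjoint_left]
    intro P hP hP'
    simp only [Finset.mem_filter, mem_ncPartitions] at hP hP'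
    obtain ⟨hP, V, hV, hxV, hyV, hm⟩ := hP
    obtain ⟨-, W, hW, hxW, hyW, hm'⟩ := hP'
    obtain rfl := hP.eq_of_mem V hV W hW x hxV hxW
    exact hne (le_antisymm (hm _ hyW (h y' hy').ne') (hm' _ hyV (h y hy).ne'))

end NonCrossingSums

/-! ### Stack moments are sums over non-crossing partitions. -/

section Bridge

variable {α X R : Type*} [LinearOrder α] [CommRing R] {K : List X → R}

/-- The decomposition of a moment according to the next letter of the bottom block. -/
theorem stackMoment_append_singleton (a : α → X) (f : List X → R) (l : List α)
    (hl : l.Pairwise (· < ·)) : ∀ s : List (List X → R),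
    stackMoment K (s ++ [f]) (l.map a) = ∑ y ∈ l.toFinset,
      stackMoment K s ((l.filter (· < y)).map a) *
        (f [a y] * stackMoment K [] ((l.filter (y < ·)).map a) +
          stackMoment K [fun v => f (a y :: v)] ((l.filter (y < ·)).map a)) := by
  induction l with
  | nil =>
    intro s
    simp [stackMoment_append_nil]
  | cons z l ih =>
    obtain ⟨hz, hl⟩ := List.pairwise_cons.mp hl
    intro s
    have hzl : z ∉ l.toFinset := fun h => lt_irrefl _ (hz z (List.mem_toFinset.mp h))
    have f₁ : (z :: l).filter (· < z) = [] := by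
      rw [List.filter_eq_nil_iff]
      intro y hy
      rcases List.mem_cons.mp hy with rfl | hy
      · simp
      · simpa using (hz y hy).le
    have f₂ : (z :: l).filter (z < ·) = l := by
      rw [List.filter_cons_of_neg (by simp), List.filter_eq_self]
      exact fun y hy => by simpa using hz y hy
    have e : ∀ y ∈ l.toFinset, stackMoment K s (((z :: l).filter (· < y)).map a) *
        (f [a y] * stackMoment K [] (((z :: l).filter (y < ·)).map a) +
          stackMoment K [fun v => f (a y :: v)] (((z :: l).filter (y < ·)).map a)) =
        stackMoment K s (a z :: (l.filter (· < y)).map a) *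
        (f [a y] * stackMoment K [] ((l.filter (y < ·)).map a) +
          stackMoment K [fun v => f (a y :: v)] ((l.filter (y < ·)).map a)) := by
      intro y hy
      have hzy := hz y (List.mem_toFinset.mp hy)
      rw [List.filter_cons_of_pos (by simpa using hzy),
        List.filter_cons_of_neg (by simpa using hzy.le), List.map_cons]
    rw [List.toFinset_cons, Finset.sum_insert hzl, Finset.sum_congr rfl e, f₁, f₂, List.map_cons,
      List.map_nil]
    cases s with
    | nil =>
      have h1 := ih hl []
      have h2 := ih hl [fun v => K (a z :: v)]
      simp only [List.nil_append, List.cons_append] at h1 h2 ⊢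
      simp only [stackMoment_cons_cons, stackMoment_nil_cons, h1, h2, Finset.mul_sum, add_mul,
        Finset.sum_add_distrib, mul_assoc, stackMoment_nil_nil, one_mul]
      ring
    | cons g s =>
      have h1 := ih hl (g :: s)
      have h2 := ih hl ((fun v => K (a z :: v)) :: g :: s)
      have h3 := ih hl ((fun v => g (a z :: v)) :: s)
      have h4 := ih hl s
      simp only [List.cons_append] at h1 h2 h3 ⊢
      -- The term `y = z` is zero: the block of `g` would have to close on the empty word before the
      -- bottom block is reached.
      simp only [stackMoment_cons_cons, h1, h2, h3, h4, Finset.mul_sum, add_mul,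
        Finset.sum_add_distrib, mul_assoc, stackMoment_cons_nil]
      ring

/-- The subword of `a` on the set `V`. -/
def subword (a : α → X) (V : Finset α) : List X := (V.sort (· ≤ ·)).map a

theorem subword_insert (a : α → X) {x : α} {V : Finset α} (h : ∀ z ∈ V, x < z) :
    subword a (insert x V) = a x :: subword a V := by
  rw [subword, Finset.sort_insert _ (fun z hz => (h z hz).le) fun hx => lt_irrefl _ (h x hx)]
  rfl

/-- Removing the minimum `x` leaves a sum in which the block of the next letter `y` carries the
prefix `a x`. The induction therefore needs a second statement, with an arbitrary functional `h` on
the block of the minimum; the first is the case `h = K`. -/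
theorem ncSum_subword_aux (a : α → X) (n : ℕ) : ∀ l : List α, l.length = n →
    l.Pairwise (· < ·) →
    ncSum (fun V => K (subword a V)) l.toFinset = stackMoment K [] (l.map a) ∧
    ∀ x l', l = x :: l' → ∀ h : List X → R,
      ncSum (fun V => if x ∈ V then h (subword a V) else K (subword a V)) l.toFinset =
        h [a x] * stackMoment K [] (l'.map a) +
          stackMoment K [fun v => h (a x :: v)] (l'.map a) := by
  induction n using Nat.strong_induction_on with
  | _ n ih =>
    intro l hn hl
    have main : ∀ x l', l = x :: l' → ∀ h : List X → R,
        ncSum (fun V => if x ∈ V then h (subword a V) else K (subword a V)) l.toFinset =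
          h [a x] * stackMoment K [] (l'.map a) +
            stackMoment K [fun v => h (a x :: v)] (l'.map a) := by
      rintro x l rfl h
      obtain ⟨hx, hl⟩ := List.pairwise_cons.mp hl
      have hx' : ∀ z ∈ l.toFinset, x < z := fun z hz => hx z (List.mem_toFinset.mp hz)
      have hlen : l.length < n := by rw [← hn]; simp
      have hω : ∀ S ⊆ l.toFinset,
          ncSum (fun V => if x ∈ V then h (subword a V) else K (subword a V)) S =
            ncSum (fun V => K (subword a V)) S := fun S hS =>
        ncSum_congr fun V hV _ => if_neg fun hxV => lt_irrefl _ (hx' x (hS (hV hxV)))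
      rw [List.toFinset_cons, ncSum_insert _ hx', hω _ subset_rfl, (ih _ hlen l rfl hl).1]
      have e := stackMoment_append_singleton (K := K) a (fun v => h (a x :: v)) l hl []
      rw [List.nil_append] at e
      rw [e, if_pos (Finset.mem_singleton_self x)]
      congr 1
      · simp [subword]
      · refine Finset.sum_congr rfl fun y hy => ?_
        have hy' := List.mem_toFinset.mp hy
        have e₁ : l.toFinset.filter (· < y) = (l.filter (· < y)).toFinset := by
          ext; simp
        have e₂ : l.toFinset.filter (y ≤ ·) = (y :: l.filter (y < ·)).toFinset := by
          ext z
          simp only [Finset.mem_filter, List.mem_toFinset, List.mem_cons, List.mem_filter,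
            decide_eq_true_eq, le_iff_eq_or_lt]
          constructor
          · rintro ⟨hz, rfl | hyz⟩
            · exact Or.inl rfl
            · exact Or.inr ⟨hz, hyz⟩
          · rintro (rfl | ⟨hz, hyz⟩)
            · exact ⟨hy', Or.inl rfl⟩
            · exact ⟨hz, Or.inr hyz⟩
        rw [hω _ (Finset.filter_subset _ _), e₁,
          (ih _ ((List.length_filter_le _ _).trans_lt hlen) _ rfl (hl.filter _)).1]
        congr 1
        have e₃ : ncSum (fun V => if x ∈ attach x y V then h (subword a (attach x y V))
            else K (subword a (attach x y V))) (l.toFinset.filter (y ≤ ·)) =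
            ncSum (fun V => if y ∈ V then (fun v => h (a x :: v)) (subword a V)
              else K (subword a V)) (l.toFinset.filter (y ≤ ·)) := by
          refine ncSum_congr fun V hV _ => ?_
          have hV' : ∀ z ∈ V, x < z := fun z hz => hx' z (Finset.mem_filter.mp (hV hz)).1
          have hxV : x ∉ V := fun hxV => lt_irrefl _ (hV' x hxV)
          by_cases hyV : y ∈ V
          · simp only [attach, if_pos hyV, Finset.mem_insert_self, if_true, subword_insert a hV']
          · simp only [attach, if_neg hyV, if_neg hxV]
        -- The filter drops `y` itself, so putting `y` back does not exceed the length of `l`, and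
        -- the induction hypothesis applies.
        have hsub : (y :: l.filter (y < ·)).length ≤ l.length := by
          rw [List.length_cons, Nat.succ_le_iff]
          refine lt_of_le_of_ne (List.length_filter_le _ _) fun he => ?_
          simpa using List.length_filter_eq_length_iff.mp he y hy'
        rw [e₃, e₂]
        refine (ih _ (hsub.trans_lt hlen) _ rfl ?_).2 y _ rfl (fun v => h (a x :: v))
        exact List.pairwise_cons.mpr ⟨fun z hz => by simpa using (List.mem_filter.mp hz).2,
          hl.filter _⟩
    refine ⟨?_, main⟩
    cases l with
    | nil => simp [ncSum_empty, stackMoment_nil_nil]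
    | cons x l =>
      rw [List.map_cons, stackMoment_nil_cons, ← main x l rfl K]
      exact ncSum_congr fun V _ _ => by simp

/-- The moment-cumulant formula, with the sum over non-crossing partitions. -/
theorem ncSum_subword (a : α → X) (l : List α) (hl : l.Pairwise (· < ·)) :
    ncSum (fun V => K (subword a V)) l.toFinset = stackMoment K [] (l.map a) :=
  (ncSum_subword_aux a _ l rfl hl).1

theorem ofFn_restrict {n : ℕ} (a : Fin n → X) (V : Finset (Fin n)) :
    List.ofFn (restrict a V) = subword a V := by
  refine List.ext_getElem (by simp [subword]) fun i h₁ h₂ => ?_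
  simp [subword, restrict, Finset.orderEmbOfFin_apply]

theorem sum_nc_prod {n : ℕ} (ω : Finset (Fin n) → R) :
    ∑ p : NC n, ∏ V : p.Block, ω V.1 = ncSum ω Finset.univ := by
  refine Finset.sum_bij (fun p _ => p.1.parts) ?_ ?_ ?_ ?_
  · intro p _
    rw [mem_ncPartitions]
    exact {
      nonempty := fun V hV => p.1.nonempty_of_mem_parts hV
      subset := fun V _ => Finset.subset_univ V
      cover := fun x hx => p.1.exists_mem hx
      eq_of_mem := fun V hV W hW x hxV hxW => p.1.eq_of_mem_parts hV hW hxV hxW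
      nonCrossing := p.2 }
  · intro p _ q _ h
    exact Subtype.ext (Finpartition.ext h)
  · intro P hP
    rw [mem_ncPartitions] at hP
    refine ⟨⟨⟨P, ?_, ?_, ?_⟩, hP.nonCrossing⟩, Finset.mem_univ _, rfl⟩
    · rw [Finset.supIndep_iff_pairwiseDisjoint]
      intro V hV W hW hne
      rw [Function.onFun, id, id, Finset.disjoint_left]
      exact fun x hxV hxW => hne (hP.eq_of_mem V hV W hW x hxV hxW)
    · refine Finset.eq_univ_of_forall fun x => ?_
      obtain ⟨V, hV, hxV⟩ := hP.cover x (Finset.mem_univ x)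
      exact Finset.mem_sup.mpr ⟨V, hV, hxV⟩
    · exact fun h => Finset.not_nonempty_empty (hP.nonempty ∅ h)
  · intro p _
    exact Finset.prod_coe_sort p.1.parts ω

theorem sum_nc_prod_restrict {n : ℕ} (a : Fin n → X) :
    ∑ p : NC n, ∏ V : p.Block, K (List.ofFn (restrict a V.1)) =
      stackMoment K [] (List.ofFn a) := by
  simp only [ofFn_restrict]
  rw [sum_nc_prod (fun V => K (subword a V)), List.ofFn_eq_map, ← List.toFinset_finRange,
    ncSum_subword a _ (List.sortedLT_finRange n).pairwise]

end Bridge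

/-! ### The exponential of a derivation and the extension of scalars to power series. -/

section PowerSeriesLift

variable {A : Type*} [Ring A] [Algebra ℂ A]

theorem IsDerivation.pow_mul {D : Module.End ℂ A} (hD : IsDerivation D) (n : ℕ) (a b : A) :
    (D ^ n) (a * b) =
      ∑ ij ∈ Finset.HasAntidiagonal.antidiagonal n, n.choose ij.1 • ((D ^ ij.1) a * (D ^ ij.2) b) := by
  induction n with
  | zero => simp
  | succ n ih =>
    rw [pow_succ', Module.End.mul_apply, ih, map_sum,
      Finset.sum_antidiagonal_choose_succ_nsmul (fun i j => (D ^ i) a * (D ^ j) b) n,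
      ← Finset.sum_add_distrib]
    refine Finset.sum_congr rfl fun ij hij => ?_
    rw [map_nsmul, hD, pow_succ', pow_succ', Module.End.mul_apply, Module.End.mul_apply,
      nsmul_add, add_comm, Nat.choose_symm_of_eq_add (Finset.HasAntidiagonal.mem_antidiagonal.mp hij).symm]

/-- The homomorphism `a ↦ ∑ X ^ i D ^ i a / i!`. -/
noncomputable def IsDerivation.exp {D : Module.End ℂ A} (hD : IsDerivation D) :
    A →* PowerSeries A where
  toFun a := PowerSeries.mk fun i => ((i.factorial : ℂ)⁻¹) • (D ^ i) a
  map_one' := by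
    ext i
    rw [PowerSeries.coeff_mk, PowerSeries.coeff_one]
    cases i with
    | zero => simp
    | succ i => simp [pow_succ, hD.map_one]
  map_mul' a b := by
    ext n
    rw [PowerSeries.coeff_mk, PowerSeries.coeff_mul, hD.pow_mul, Finset.smul_sum]
    refine Finset.sum_congr rfl fun ij hij => ?_
    rw [PowerSeries.coeff_mk, PowerSeries.coeff_mk, smul_mul_smul_comm, ← Nat.cast_smul_eq_nsmul ℂ,
      smul_smul]
    congr 1
    have h := Finset.HasAntidiagonal.mem_antidiagonal.mp hij
    have h1 : (ij.1.factorial : ℂ) ≠ 0 := by exact_mod_cast ij.1.factorial_ne_zero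
    have h2 : (ij.2.factorial : ℂ) ≠ 0 := by exact_mod_cast ij.2.factorial_ne_zero
    rw [← h, Nat.cast_add_choose, inv_mul_eq_div, div_right_comm, div_self, one_div, mul_inv]
    exact_mod_cast (ij.1 + ij.2).factorial_ne_zero

theorem IsDerivation.coeff_exp {D : Module.End ℂ A} (hD : IsDerivation D) (a : A) (i : ℕ) :
    PowerSeries.coeff i (hD.exp a) = ((i.factorial : ℂ)⁻¹) • (D ^ i) a := by
  rw [IsDerivation.exp, MonoidHom.coe_mk, OneHom.coe_mk, PowerSeries.coeff_mk]

theorem coeff_map_algebraMap_mul (c : PowerSeries ℂ) (f : PowerSeries A) (n : ℕ) :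
    PowerSeries.coeff n (PowerSeries.map (algebraMap ℂ A) c * f) =
      ∑ ij ∈ Finset.HasAntidiagonal.antidiagonal n, PowerSeries.coeff ij.1 c • PowerSeries.coeff ij.2 f := by
  simp only [PowerSeries.coeff_mul, PowerSeries.coeff_map, Algebra.smul_def]

/-- The algebra of formal power series over a noncommutative algebra. -/
@[reducible]
noncomputable def powerSeriesAlgebra (A : Type*) [Ring A] [Algebra ℂ A] :
    Algebra (PowerSeries ℂ) (PowerSeries A) :=
  (PowerSeries.map (algebraMap ℂ A)).toAlgebra' fun c f => by
    ext n
    rw [PowerSeries.coeff_mul, PowerSeries.coeff_mul, ← Finset.Nat.sum_antidiagonal_swap]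
    refine Finset.sum_congr rfl fun ij _ => ?_
    rw [PowerSeries.coeff_map, PowerSeries.coeff_map]
    exact Algebra.commutes _ _

variable [Algebra (PowerSeries ℂ) (PowerSeries A)]

/-- The coefficientwise application of a linear functional. -/
noncomputable def seriesFunctional (φ : A →ₗ[ℂ] ℂ)
    (h : ∀ (c : PowerSeries ℂ) (f : PowerSeries A),
      c • f = PowerSeries.map (algebraMap ℂ A) c * f) :
    PowerSeries A →ₗ[PowerSeries ℂ] PowerSeries ℂ where
  toFun f := PowerSeries.mk fun n => φ (PowerSeries.coeff n f)
  map_add' f g := by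
    ext n
    simp
  map_smul' c f := by
    ext n
    rw [PowerSeries.coeff_mk, h, coeff_map_algebraMap_mul, RingHom.id_apply, smul_eq_mul,
      PowerSeries.coeff_mul]
    simp

theorem coeff_seriesFunctional (φ : A →ₗ[ℂ] ℂ)
    (h : ∀ (c : PowerSeries ℂ) (f : PowerSeries A),
      c • f = PowerSeries.map (algebraMap ℂ A) c * f) (f : PowerSeries A) (n : ℕ) :
    PowerSeries.coeff n (seriesFunctional φ h f) = φ (PowerSeries.coeff n f) := by
  unfold seriesFunctional
  exact PowerSeries.coeff_mk n fun n => φ (PowerSeries.coeff n f)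

/-- The power series with coefficients in a subalgebra. -/
def seriesSubalgebra (B : Subalgebra ℂ A)
    (h : ∀ (c : PowerSeries ℂ) (f : PowerSeries A),
      c • f = PowerSeries.map (algebraMap ℂ A) c * f) :
    Subalgebra (PowerSeries ℂ) (PowerSeries A) where
  carrier := {f | ∀ n, PowerSeries.coeff n f ∈ B}
  mul_mem' {f g} hf hg n := by
    rw [PowerSeries.coeff_mul]
    exact sum_mem fun ij _ => mul_mem (hf _) (hg _)
  add_mem' {f g} hf hg n := by
    rw [map_add]
    exact add_mem (hf n) (hg n)
  algebraMap_mem' c n := by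
    rw [Algebra.algebraMap_eq_smul_one, h, mul_one, PowerSeries.coeff_map]
    exact B.algebraMap_mem _

end PowerSeriesLift

/-! ### Transfer of freeness and of infinitesimal cumulants. -/

theorem apply_coeff_prod_eq_zero {A : Type*} [Ring A] [Algebra ℂ A] (l : List (PowerSeries A)) :
    ∀ ψ : A →ₗ[ℂ] ℂ,
    (∀ c : List A, List.Forall₂ (fun a f => ∃ n, a = PowerSeries.coeff n f) c l →
      ψ c.prod = 0) → ∀ n, ψ (PowerSeries.coeff n l.prod) = 0 := by
  induction l with
  | nil =>
    intro ψ h n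
    rw [List.prod_nil, PowerSeries.coeff_one]
    split_ifs
    · exact h [] .nil
    · exact map_zero ψ
  | cons f l ih =>
    intro ψ h n
    rw [List.prod_cons, PowerSeries.coeff_mul, map_sum]
    refine Finset.sum_eq_zero fun ij _ => ?_
    -- The coefficient of the first factor is absorbed into the functional, which is why `ψ` is
    -- arbitrary.
    refine ih (ψ ∘ₗ LinearMap.mulLeft ℂ (PowerSeries.coeff ij.1 f)) (fun c hc => ?_) ij.2
    simpa using h (PowerSeries.coeff ij.1 f :: c) (.cons ⟨_, rfl⟩ hc)

theorem NCProbSpace.Free.apply_prod_eq_zero {A : Type*} [Ring A] [Algebra ℂ A]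
    {P : NCProbSpace A} {ι : Type*} {B : ι → Subalgebra ℂ A} (hfree : P.Free B)
    (c : List (ι × A)) (hc : c ≠ []) (hchain : c.IsChain fun x y => x.1 ≠ y.1)
    (hB : ∀ x ∈ c, x.2 ∈ B x.1) (h0 : ∀ x ∈ c, P.φ x.2 = 0) : P.φ (c.map Prod.snd).prod = 0 := by
  obtain ⟨m, hm⟩ := Nat.exists_eq_succ_of_ne_zero (mt List.length_eq_zero_iff.mp hc)
  obtain ⟨f, rfl⟩ : ∃ f : Fin (m + 1) → ι × A, c = List.ofFn f :=
    ⟨fun s => c.get (s.cast hm.symm), by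
      refine List.ext_getElem (by simp [hm]) fun i h₁ h₂ => by simp [List.getElem_ofFn, -List.ofFn_succ]⟩
  rw [List.map_ofFn]
  refine hfree m (fun s => (f s).1) _ (fun s => ?_) (fun s => hB _ (List.mem_ofFn.mpr ⟨s, rfl⟩))
    (fun s => h0 _ (List.mem_ofFn.mpr ⟨s, rfl⟩))
  have h := List.isChain_iff_getElem.mp hchain s (by simp)
  rw [List.getElem_ofFn, List.getElem_ofFn] at h
  exact h

/-- The multinomial coefficient times the product of the factorials `(l V)!` is `i!`; what remains
is the Cauchy product. Every entry is at most `i ≤ k`, so nothing is lost by working in `Fin (k +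
1)`. -/
theorem sum_weights_multinomial {ι : Type*} [Fintype ι] [DecidableEq ι] {k : ℕ} (i : Fin (k + 1))
    (F : ι → PowerSeries ℂ) :
    ∑ l ∈ weights ι i, (Nat.multinomial Finset.univ (fun V => (l V : ℕ)) : ℂ) *
      ∏ V, (((l V : ℕ).factorial : ℂ) * PowerSeries.coeff (l V : ℕ) (F V)) =
    ((i : ℕ).factorial : ℂ) * PowerSeries.coeff (i : ℕ) (∏ V, F V) := by
  rw [PowerSeries.coeff_prod, Finset.mul_sum]
  refine Finset.sum_bij (fun l _ => Finsupp.equivFunOnFinite.symm fun V => (l V : ℕ)) ?_ ?_ ?_ ?_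
  · intro l hl
    rw [weights, Finset.mem_filter] at hl
    simpa [Finset.mem_finsuppAntidiag] using hl.2
  · intro l _ l' _ h
    funext V
    exact Fin.ext (DFunLike.congr_fun h V)
  · intro l hl
    rw [Finset.mem_finsuppAntidiag] at hl
    have hle : ∀ V, l V < k + 1 := fun V =>
      lt_of_le_of_lt (hl.1 ▸ Finset.single_le_sum (fun _ _ => Nat.zero_le _) (Finset.mem_univ V))
        i.2
    refine ⟨fun V => ⟨l V, hle V⟩, ?_, ?_⟩
    · simpa [weights] using hl.1
    · ext V
      rfl
  · intro l hl
    rw [weights, Finset.mem_filter] at hl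
    have h := Nat.multinomial_spec Finset.univ fun V => (l V : ℕ)
    rw [hl.2] at h
    rw [Finset.prod_mul_distrib, ← mul_assoc, ← h]
    push_cast
    rw [mul_comm (Nat.multinomial _ _ : ℂ)]
    rfl

/-- Every coefficient of the product is a sum of products of coefficients, and each of these is a
centred alternating word in `A`, killed by freeness. -/
theorem NCProbSpace.Free.seriesFunctional_eq_zero {A : Type*} [Ring A] [Algebra ℂ A]
    [Algebra (PowerSeries ℂ) (PowerSeries A)] {P : NCProbSpace A} {ι : Type*}
    {B : ι → Subalgebra ℂ A} (hfree : P.Free B)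
    (h : ∀ (c : PowerSeries ℂ) (f : PowerSeries A),
      c • f = PowerSeries.map (algebraMap ℂ A) c * f)
    (c : List (ι × PowerSeries A)) (hc : c ≠ [])
    (hca : IsCentredAlternating (seriesFunctional P.φ h) (fun i => seriesSubalgebra (B i) h) c) :
    seriesFunctional P.φ h (c.reverse.map Prod.snd).prod = 0 := by
  ext n
  rw [coeff_seriesFunctional, map_zero]
  refine apply_coeff_prod_eq_zero _ P.φ (fun d hd => ?_) n
  -- Gives a word of coefficients the colours of the series they are taken from.
  have key : ∀ (w : List (ι × PowerSeries A)) (d : List A),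
      List.Forall₂ (fun a f => ∃ n, a = PowerSeries.coeff n f) d (w.map Prod.snd) →
      ∃ v : List (ι × A), v.map Prod.fst = w.map Prod.fst ∧ v.map Prod.snd = d ∧
        ∀ x ∈ v, ∃ y ∈ w, x.1 = y.1 ∧ ∃ n, x.2 = PowerSeries.coeff n y.2 := by
    intro w
    induction w with
    | nil =>
      intro d hd
      rw [List.map_nil, List.forall₂_nil_right_iff] at hd
      exact ⟨[], by simp [hd]⟩
    | cons y w ih =>
      intro d hd
      rw [List.map_cons, List.forall₂_cons_right_iff] at hd
      obtain ⟨a, d, ha, hd, rfl⟩ := hd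
      obtain ⟨v, h₁, h₂, h₃⟩ := ih d hd
      refine ⟨(y.1, a) :: v, by simp [h₁], by simp [h₂], fun x hx => ?_⟩
      rcases List.mem_cons.mp hx with rfl | hx
      · exact ⟨y, by simp, rfl, ha⟩
      · obtain ⟨z, hz, hz'⟩ := h₃ x hx
        exact ⟨z, by simp [hz], hz'⟩
  obtain ⟨v, h₁, rfl, h₃⟩ := key _ d hd
  refine hfree.apply_prod_eq_zero v (fun hv => hc ?_) ?_ (fun x hx => ?_) fun x hx => ?_
  · simpa [hv] using h₁
  · have e := (List.isChain_map (R := fun i j : ι => i ≠ j) Prod.fst (l := c.reverse)).mpr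
      (List.isChain_reverse.mpr (hca.chain.imp fun _ _ h => h.symm))
    rw [← h₁] at e
    exact (List.isChain_map Prod.fst).mp e
  · obtain ⟨y, hy, e, n, hn⟩ := h₃ x hx
    rw [e, hn]
    exact hca.mem y (List.mem_reverse.mp hy) n
  · obtain ⟨y, hy, -, n, hn⟩ := h₃ x hx
    rw [hn]
    have h0 := congrArg (PowerSeries.coeff n) (hca.centred y (List.mem_reverse.mp hy))
    rwa [coeff_seriesFunctional, map_zero] at h0

/-- The infinitesimal cumulants of the upgrade of `φ` by `D` are, up to factorials, the coefficients
of the cumulants of the power series valued functional. -/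
theorem cumulant_upgrade {A : Type*} [Ring A] [Algebra ℂ A] (P : NCProbSpace A)
    {D : Module.End ℂ A} (hD : IsDerivation D) (k : ℕ) {K : List (PowerSeries A) → PowerSeries ℂ}
    (hK : ∀ (w : List (PowerSeries A)) n, PowerSeries.coeff n (stackMoment K [] w) =
      P.φ (PowerSeries.coeff n w.prod)) {m : ℕ} (hm : 1 ≤ m) (i : Fin (k + 1)) (a : Fin m → A) :
    (P.upgrade D hD k).cumulant m i a =
      ((i : ℕ).factorial : ℂ) * PowerSeries.coeff (i : ℕ) (K (List.ofFn (hD.exp ∘ a))) := by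
  refine (congrFun (congrFun ((P.upgrade D hD k).cumulant_unique
    (fun m i a => ((i : ℕ).factorial : ℂ) * PowerSeries.coeff (i : ℕ) (K (List.ofFn (hD.exp ∘ a))))
    (fun m hm i a => ?_) m hm) i) a).symm
  simp only [blockSum]
  calc _ = ∑ p : NC m, ((i : ℕ).factorial : ℂ) * PowerSeries.coeff (i : ℕ)
          (∏ V : p.Block, K (List.ofFn (restrict (hD.exp ∘ a) V.1))) :=
        Finset.sum_congr rfl fun p _ => sum_weights_multinomial i fun V : p.Block =>
          K (List.ofFn (restrict (hD.exp ∘ a) V.1))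
    _ = ((i : ℕ).factorial : ℂ) * P.φ (PowerSeries.coeff (i : ℕ)
          (List.ofFn (hD.exp ∘ a)).prod) := by
        rw [← Finset.mul_sum, ← map_sum, sum_nc_prod_restrict, hK]
    _ = _ := by
        have h : ((i : ℕ).factorial : ℂ) ≠ 0 := by exact_mod_cast (i : ℕ).factorial_ne_zero
        -- By multiplicativity the product of exponentials is the exponential of the product, whose
        -- `i`-th coefficient is `D ^ i` of that product over `i!`.
        rw [← List.map_ofFn, ← map_list_prod, hD.coeff_exp, map_smul, smul_eq_mul,
          mul_inv_cancel_left₀ h]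
        rfl

end FreeProb

theorem mainTheorem6 {A : Type*} [Ring A] [Algebra ℂ A] (P : FreeProb.NCProbSpace A)
    (D : Module.End ℂ A) (hD : FreeProb.IsDerivation D) (k : ℕ)
    {n : ℕ} (B : Fin n → Subalgebra ℂ A) (hfree : P.Free B)
    (hDB : ∀ j : Fin n, ∀ a ∈ B j, D a ∈ B j) :
    (P.upgrade D hD k).InfFree (fun j => (B j : Set A)) := by
  let _ := FreeProb.powerSeriesAlgebra A
  have h : ∀ (c : PowerSeries ℂ) (f : PowerSeries A),
      c • f = PowerSeries.map (algebraMap ℂ A) c * f := fun _ _ => rfl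
  have hΦ : FreeProb.seriesFunctional P.φ h 1 = 1 := by
    ext i
    rw [FreeProb.coeff_seriesFunctional, PowerSeries.coeff_one, PowerSeries.coeff_one]
    split_ifs
    · exact P.map_one
    · exact map_zero _
  have hK := FreeProb.stackMoment_wordCumulant
    (fun w : List (PowerSeries A) => FreeProb.seriesFunctional P.φ h w.prod) hΦ
  intro i m j a ha ⟨s, t, _, hst⟩
  have hm : 1 ≤ m := s.pos
  have hDB' : ∀ (r : ℕ) (j : Fin n), ∀ a ∈ B j, (D ^ r) a ∈ B j := by
    intro r j a ha
    induction r with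
    | zero => exact ha
    | succ r ih =>
      rw [pow_succ', Module.End.mul_apply]
      exact hDB j _ ih
  rw [FreeProb.cumulant_upgrade P hD k
    (fun w r => by rw [hK, FreeProb.coeff_seriesFunctional]) hm]
  have hmono := FreeProb.cumulant_eq_monochromaticCumulant hΦ hK
    (hfree.seriesFunctional_eq_zero h) (List.ofFn fun s => (j s, hD.exp (a s)))
    (by simpa using (Nat.one_le_iff_ne_zero.mp hm)) (fun x hx => by
      obtain ⟨s, rfl⟩ := List.mem_ofFn.mp hx
      intro r
      rw [hD.coeff_exp]
      exact (B (j s)).smul_mem (hDB' r _ _ (ha s)) _)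
  rw [List.map_ofFn] at hmono
  have h0 : FreeProb.monochromaticCumulant (FreeProb.wordCumulant
      fun w : List (PowerSeries A) => FreeProb.seriesFunctional P.φ h w.prod)
      (List.ofFn fun s => (j s, hD.exp (a s))) = 0 := by
    obtain ⟨m, rfl⟩ := Nat.exists_eq_succ_of_ne_zero (Nat.one_le_iff_ne_zero.mp hm)
    rw [List.ofFn_succ]
    -- The monochromatic functional compares colours with the first letter; two distinct colours
    -- cannot both equal that of the first.
    obtain ⟨u, hu⟩ : ∃ u, j u ≠ j 0 := by
      by_contra hcon
      push Not at hcon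
      exact hst ((hcon s).trans (hcon t).symm)
    obtain ⟨v, rfl⟩ := Fin.exists_succ_eq.mpr fun h0 => hu (congrArg j h0)
    exact FreeProb.monochromaticCumulant_eq_zero (y := (j v.succ, hD.exp (a v.succ)))
      (List.mem_ofFn.mpr ⟨v, rfl⟩) hu
  rw [h0] at hmono
  have hmono' : FreeProb.wordCumulant
      (fun w : List (PowerSeries A) => FreeProb.seriesFunctional P.φ h w.prod)
      (List.ofFn (hD.exp ∘ a)) = 0 := hmono
  rw [hmono', map_zero, mul_zero]
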